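/- Let $d\ge 1$, $T,L>0$, $\Omega=(0,L)^d$, $Q_T=(0,T)\times\Omega$. Assume: * $J\in BV(\mathbb R^d\times\mathbb R^d)$ is symmetric and non-negative, $\int_{\Omega\times\Omega}J=1$, and $J\in L^\infty(\Omega\times\Omega)$; * $A:\mathbb R\to\mathbb R$ is locally Lipschitz, $A(-s)=-A(s)$ and $A(s)s\ge 0$ for all $s$; * $f(\cdot,\cdot,s)\in L^\infty(Q_T)\cap BV(Q_T)$ for each $s\in\mathbb R$, $f(t,\mathbf x,\cdot)$ is Lipschitz on bounded intervals uniformly for a.e. $(t,\mathbf x)\in Q_T$, $|f(\cdot,\cdot,s)|\le C_f(1+|s|)$ in $Q_T$ for some $C_f>0$, and $f(\cdot,\cdot,0)\ge 0$; * $u_0\in L^\infty(\Omega)\cap BV(\Omega)$, $u_0\ge 0$. Let $u\in W^{1,\infty}(0,T;L^\infty(\Omega))\cap C([0,T];L^\infty(\Omega)\cap BV(\Omega))$ be a solution of $$\partial_t u(t,\mathbf x)=\int_\Omega J(\mathbf x,\mathbf y)A(u(t,\mathbf y)-u(t,\mathbf x))\,d\mathbf y+f(t,\mathbf x,u(t,\mathbf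 x)),\qquad u(0,\mathbf x)=u_0(\mathbf x),$$ and let $[C_m,C_M]$ be an interval containing the values of $u$ a.e. in $Q_T$. Given positive integers $N$, $J_\Omega$, $L_Q$, $L_R$, set $\tau=T/N$, $t_n=n\tau$, $h=L/J_\Omega$; let $\Omega_{\mathbf j}$, $\mathbf j\in\{1,\dots,J_\Omega\}^d$, be the open cube of side $h$ and centre $(\mathbf j-\tfrac{\mathbf 1}{2})h$; and put $q=(C_M-C_m)/L_Q$, $q_i=C_M-iq$ $(0\le i\le L_Q)$, $r=(\sup J-\inf J)/L_R$, $r_m=\sup J-mr$ $(0\le m\le L_R)$, with essential $\sup$ and $\inf$ over $\Omega\times\Omega$. Let $\iota_Q(\rho)$, $\iota_R(\rho)$ be the index of a point of $\{q_i\}$, respectively $\{r_m\}$, nearest to $\rho\in\mathbb R$ (ties broken arbitrarily, but measurably). For cell values $v=(v[\mathbf j])_{\mathbf j}$ let $U_i=\bigcup\{\Omega_{\mathbf k}:\iota_Q(v[\mathbf k])=i\}$, $\mu_m^i(\mathbf x)=\operatorname{meas}\{\mathbf y\in U_i:\iota_R(J(\mathbf x,\mathbf y))=m\}$, $\mu_m^i[\mathbf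 j]=h^{-d}\int_{\Omega_{\mathbf j}}\mu_m^i(\mathbf x)\,d\mathbf x$, and, with $k=\iota_Q(v[\mathbf j])$, $$\mathcal A_h(v)[\mathbf j]=\sum_{i=0}^{L_Q}A(q_i-q_k)\sum_{m=0}^{L_R}r_m\,\mu_m^i[\mathbf j].$$ Let $u^0[\mathbf j]=h^{-d}\int_{\Omega_{\mathbf j}}u_0$, $f_{n\mathbf j}(s)=\frac1{\tau h^d}\int_{t_n}^{t_{n+1}}\int_{\Omega_{\mathbf j}}f(t,\mathbf x,s)\,d\mathbf x\,dt$, and $$u^{n+1}[\mathbf j]=u^n[\mathbf j]+\tau\big(\mathcal A_h(u^n)[\mathbf j]+f_{n\mathbf j}(u^n[\mathbf j])\big),\qquad 0\le n<N,$$ and let $u_{\tau h}(t,\mathbf x)=u^n[\mathbf j]$ for $(t,\mathbf x)\in[t_n,t_{n+1})\times\Omega_{\mathbf j}$. Then there is a constant $C>0$, independent of $N,J_\Omega,L_Q,L_R$ (hence of $\tau,h,q,r$) and of the tie-breaking, such that $$\|u-u_{\tau h}\|_{L^\infty(0,T;L^1(\Omega))}\le C(\tau+h+q+r).$$ -/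

import Mathlib

open MeasureTheory Set Filter Topology
open scoped ENNReal NNReal

namespace NonlocalDiffusion

noncomputable section

/-! ### Functions of bounded variation -/

section BV

variable {ι V : Type*} [Fintype ι] [NormedAddCommGroup V] [NormedSpace ℝ V]

/-- `φ = (φ i)` is a compactly supported `C¹` vector field on the open set `U` with
Euclidean length at most one everywhere. -/
structure IsTestField (U : Set V) (φ : ι → V → ℝ) : Prop where
  contDiff : ∀ i, ContDiff ℝ 1 (φ i)
  compact : ∀ i, HasCompactSupport (φ i)
  support : ∀ i, tsupport (φ i) ⊆ U
  length_le : ∀ x, ∑ i, φ i x ^ 2 ≤ 1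

variable [MeasureSpace V]

/-- Total variation `|Dg|(U) = sup { ∫_U g div φ }`, where `div φ = ∑ i, ∂_{e i} (φ i)` is the
divergence in the coordinate directions `e i`. -/
def variation (e : ι → V) (U : Set V) (g : V → ℝ) : ℝ≥0∞ :=
  ⨆ (φ : ι → V → ℝ) (_ : IsTestField U φ),
    ENNReal.ofReal (∫ x in U, g x * ∑ i, fderiv ℝ (φ i) x (e i))

/-- `g ∈ BV(U)`. -/
def MemBV (e : ι → V) (U : Set V) (g : V → ℝ) : Prop :=
  MemLp g 1 (volume.restrict U) ∧ variation e U g < ∞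

/-- The norm of `L^∞(U) ∩ BV(U)`. -/
def linftyBVNorm (e : ι → V) (U : Set V) (g : V → ℝ) : ℝ≥0∞ :=
  eLpNorm g ∞ (volume.restrict U) + eLpNorm g 1 (volume.restrict U) + variation e U g

end BV

/-- Coordinate directions of `ℝ^d`. -/
def dirs (d : ℕ) (i : Fin d) : Fin d → ℝ := Pi.single i 1

/-- Coordinate directions of `ℝ^d × ℝ^d`. -/
def dirsProd (d : ℕ) : Fin d ⊕ Fin d → (Fin d → ℝ) × (Fin d → ℝ) :=
  Sum.elim (fun i => (dirs d i, 0)) (fun i => (0, dirs d i))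

/-- Coordinate directions of the time-space `ℝ × ℝ^d`. -/
def dirsTime (d : ℕ) : Option (Fin d) → ℝ × (Fin d → ℝ)
  | none => (1, 0)
  | some i => (0, dirs d i)

/-! ### The evolution problem -/

/-- The hypercube `Ω = (0, ℓ)^d`. -/
def cube (d : ℕ) (ℓ : ℝ) : Set (Fin d → ℝ) := {x | ∀ k, x k ∈ Ioo 0 ℓ}

/-- The time-space cylinder `(0, T) × Ω`. -/
def timeSpace (d : ℕ) (T ℓ : ℝ) : Set (ℝ × (Fin d → ℝ)) := Ioo 0 T ×ˢ cube d ℓ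

/-- Assumptions on the spatial kernel. -/
structure IsSpatialKernel (d : ℕ) (ℓ : ℝ) (J : (Fin d → ℝ) → (Fin d → ℝ) → ℝ) : Prop where
  memBV : MemBV (dirsProd d) univ (fun z : (Fin d → ℝ) × (Fin d → ℝ) => J z.1 z.2)
  symm : ∀ᵐ z : (Fin d → ℝ) × (Fin d → ℝ), J z.1 z.2 = J z.2 z.1
  nonneg : ∀ᵐ z : (Fin d → ℝ) × (Fin d → ℝ), 0 ≤ J z.1 z.2
  integral_eq_one : ∫ z in cube d ℓ ×ˢ cube d ℓ, J z.1 z.2 = 1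

/-- Assumptions on the range kernel; `LocallyLipschitz` is `W^{1,∞}_loc(ℝ)`. -/
structure IsRangeKernel (A : ℝ → ℝ) : Prop where
  locallyLipschitz : LocallyLipschitz A
  odd : ∀ s, A (-s) = -A s
  sign : ∀ s, 0 ≤ A s * s

/-- Assumptions on the reaction function: bounded and `BV` in `(t, x)` for each `s`, locally
Lipschitz in `s` uniformly in `(t, x)`, of at most linear growth in `s`, non-negative at `s = 0`. -/
structure IsReaction (d : ℕ) (T ℓ : ℝ) (f : ℝ → (Fin d → ℝ) → ℝ → ℝ) : Prop where
  memLinfty : ∀ s, MemLp (fun p : ℝ × (Fin d → ℝ) => f p.1 p.2 s) ∞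
    (volume.restrict (timeSpace d T ℓ))
  memBV : ∀ s, MemBV (dirsTime d) (timeSpace d T ℓ) (fun p => f p.1 p.2 s)
  lipschitz : ∀ R : ℝ, ∃ K : ℝ≥0, ∀ᵐ p ∂(volume.restrict (timeSpace d T ℓ)),
    LipschitzOnWith K (f p.1 p.2) (Icc (-R) R)
  growth : ∃ Cf > 0, ∀ s, ∀ᵐ p ∂(volume.restrict (timeSpace d T ℓ)),
    |f p.1 p.2 s| ≤ Cf * (1 + |s|)
  nonneg : ∀ᵐ p ∂(volume.restrict (timeSpace d T ℓ)), 0 ≤ f p.1 p.2 0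

/-- Assumptions on the initial datum. -/
structure IsInitialDatum (d : ℕ) (ℓ : ℝ) (u₀ : (Fin d → ℝ) → ℝ) : Prop where
  memLinfty : MemLp u₀ ∞ (volume.restrict (cube d ℓ))
  memBV : MemBV (dirs d) (cube d ℓ) u₀
  nonneg : ∀ᵐ x ∂(volume.restrict (cube d ℓ)), 0 ≤ u₀ x

/-- The nonlocal operator `𝒜(v)(x) = ∫_Ω J(x,y) A(v(y) - v(x)) dy`. -/
def nonlocalOp {d : ℕ} (ℓ : ℝ) (J : (Fin d → ℝ) → (Fin d → ℝ) → ℝ) (A : ℝ → ℝ)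
    (v : (Fin d → ℝ) → ℝ) (x : Fin d → ℝ) : ℝ :=
  ∫ y in cube d ℓ, J x y * A (v y - v x)

/-- `u ∈ W^{1,∞}(0,T;L^∞(Ω)) ∩ C([0,T];L^∞(Ω) ∩ BV(Ω))` solves
`∂_t u = 𝒜(u) + f(t,x,u)` a.e. in `(0,T) × Ω`, `u(0,·) = u₀`. -/
structure IsSolution {d : ℕ} (T ℓ : ℝ) (J : (Fin d → ℝ) → (Fin d → ℝ) → ℝ) (A : ℝ → ℝ)
    (f : ℝ → (Fin d → ℝ) → ℝ → ℝ) (u₀ : (Fin d → ℝ) → ℝ) (u : ℝ → (Fin d → ℝ) → ℝ) : Prop where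
  measurable : AEStronglyMeasurable (fun p : ℝ × (Fin d → ℝ) => u p.1 p.2)
    (volume.restrict (timeSpace d T ℓ))
  memLinfty : ∀ t ∈ Icc 0 T, MemLp (u t) ∞ (volume.restrict (cube d ℓ))
  memBV : ∀ t ∈ Icc 0 T, MemBV (dirs d) (cube d ℓ) (u t)
  continuous : ∀ t₀ ∈ Icc 0 T,
    Tendsto (fun t => linftyBVNorm (dirs d) (cube d ℓ) (fun x => u t x - u t₀ x))
      (𝓝[Icc 0 T] t₀) (𝓝 0)
  lipschitz : ∃ K : ℝ≥0, ∀ᵐ x ∂(volume.restrict (cube d ℓ)),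
    LipschitzOnWith K (fun t => u t x) (Icc 0 T)
  equation : ∀ᵐ x ∂(volume.restrict (cube d ℓ)), ∀ᵐ t ∂(volume.restrict (Ioo 0 T)),
    HasDerivAt (fun s => u s x) (nonlocalOp ℓ J A (u t) x + f t x (u t x)) t
  initial : ∀ᵐ x ∂(volume.restrict (cube d ℓ)), u 0 x = u₀ x

/-! ### The discretization

The space mesh has `M` cells of side `h` in each direction, with multi-indices
`j : Fin d → Fin M` (counted from `0`); the time step is `τ`. -/

/-- The open cell `Ω_j`, of side `h` and centre `(j + 1/2) h`. -/
def cell {d M : ℕ} (h : ℝ) (j : Fin d → Fin M) : Set (Fin d → ℝ) :=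
  {x | ∀ k, |x k - ((j k : ℝ) + 1 / 2) * h| < h / 2}

/-- The piecewise constant function with value `v j` on `Ω_j` (and zero off the cells). -/
def stepFun {d M : ℕ} (h : ℝ) (v : (Fin d → Fin M) → ℝ) (x : Fin d → ℝ) : ℝ :=
  ∑ j, (cell h j).indicator (fun _ => v j) x

/-- Cell averages. -/
def cellMean {d M : ℕ} (h : ℝ) (v : (Fin d → ℝ) → ℝ) (j : Fin d → Fin M) : ℝ :=
  1 / h ^ d * ∫ x in cell h j, v x

/-- `f_{n j}(s)`: average of `f(·,·,s)` over `(nτ, (n+1)τ) × Ω_j`. -/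
def reactionMean {d M : ℕ} (h τ : ℝ) (f : ℝ → (Fin d → ℝ) → ℝ → ℝ)
    (n : ℕ) (j : Fin d → Fin M) (s : ℝ) : ℝ :=
  1 / (τ * h ^ d) * ∫ t in (n * τ)..((n + 1) * τ), ∫ x in cell h j, f t x s

/-- The decreasing uniform mesh `top, top - step, …, top - K step`. -/
def mesh (K : ℕ) (top step : ℝ) (i : Fin (K + 1)) : ℝ := top - (i : ℝ) * step

/-- `idx` selects, measurably, the index of a point of the mesh `s` nearest to `ρ`
(ties are broken arbitrarily); the quantized value of `ρ` is `s (idx ρ)`. -/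
def IsNearestIndex {K : ℕ} (s : Fin (K + 1) → ℝ) (idx : ℝ → Fin (K + 1)) : Prop :=
  Measurable idx ∧ ∀ ρ i, |ρ - s (idx ρ)| ≤ |ρ - s i|

/-- Level set `U_i` of the quantization of the piecewise constant function with cell values `v`:
the union of the cells whose value has quantization index `i`. -/
def levelSet {d M K : ℕ} (h : ℝ) (idxQ : ℝ → Fin (K + 1)) (v : (Fin d → Fin M) → ℝ)
    (i : Fin (K + 1)) : Set (Fin d → ℝ) :=
  ⋃ k ∈ {k : Fin d → Fin M | idxQ (v k) = i}, cell h k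

/-- `μ_m^i(x)`: measure of the set of `y ∈ U_i` such that `J(x,y)` has quantization index `m`. -/
def levelMeasure {d M KQ KR : ℕ} (h : ℝ) (J : (Fin d → ℝ) → (Fin d → ℝ) → ℝ)
    (idxQ : ℝ → Fin (KQ + 1)) (idxR : ℝ → Fin (KR + 1)) (v : (Fin d → Fin M) → ℝ)
    (i : Fin (KQ + 1)) (m : Fin (KR + 1)) (x : Fin d → ℝ) : ℝ :=
  volume.real {y | y ∈ levelSet h idxQ v i ∧ idxR (J x y) = m}

/-- The discrete nonlocal operator
`∑ i, A(q_i - q_k) ∑ m, r_m μ_m^i[j]`, where `k` is the quantization index of `v j` and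
`μ_m^i[j]` is the average of `μ_m^i` over `Ω_j`. -/
def discreteOp {d M KQ KR : ℕ} (h : ℝ) (J : (Fin d → ℝ) → (Fin d → ℝ) → ℝ) (A : ℝ → ℝ)
    (q : Fin (KQ + 1) → ℝ) (r : Fin (KR + 1) → ℝ)
    (idxQ : ℝ → Fin (KQ + 1)) (idxR : ℝ → Fin (KR + 1)) (v : (Fin d → Fin M) → ℝ)
    (j : Fin d → Fin M) : ℝ :=
  ∑ i, A (q i - q (idxQ (v j))) * ∑ m, r m * cellMean h (levelMeasure h J idxQ idxR v i m) j

/-- The explicit scheme: `u^0[j]` is the mean of `u₀` over `Ω_j` and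
`u^{n+1}[j] = u^n[j] + τ (𝒜_h(u^n)[j] + f_{n j}(u^n[j]))`. -/
def scheme {d M KQ KR : ℕ} (h τ : ℝ) (J : (Fin d → ℝ) → (Fin d → ℝ) → ℝ) (A : ℝ → ℝ)
    (f : ℝ → (Fin d → ℝ) → ℝ → ℝ) (u₀ : (Fin d → ℝ) → ℝ)
    (q : Fin (KQ + 1) → ℝ) (r : Fin (KR + 1) → ℝ)
    (idxQ : ℝ → Fin (KQ + 1)) (idxR : ℝ → Fin (KR + 1)) : ℕ → (Fin d → Fin M) → ℝ
  | 0, j => cellMean h u₀ j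
  | n + 1, j =>
    let v := scheme h τ J A f u₀ q r idxQ idxR n
    v j + τ * (discreteOp h J A q r idxQ idxR v j + reactionMean h τ f n j (v j))

/-- The piecewise constant interpolator: `w n` on `Ω_j` for `nτ ≤ t < (n+1)τ`. -/
def interpolant {d M : ℕ} (h τ : ℝ) (w : ℕ → (Fin d → Fin M) → ℝ) (t : ℝ) (x : Fin d → ℝ) : ℝ :=
  stepFun h (w ⌊t / τ⌋₊) x

/-- The norm of `w` in `L^∞(0,T;L^1(Ω))`. -/
def linftyL1Norm {d : ℕ} (T ℓ : ℝ) (w : ℝ → (Fin d → ℝ) → ℝ) : ℝ≥0∞ :=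
  essSup (fun t => eLpNorm (w t) 1 (volume.restrict (cube d ℓ))) (volume.restrict (Ioo 0 T))

/-- Essential supremum of `J` over `Ω × Ω`. -/
def kernelSup {d : ℕ} (ℓ : ℝ) (J : (Fin d → ℝ) → (Fin d → ℝ) → ℝ) : ℝ :=
  essSup (fun z : (Fin d → ℝ) × (Fin d → ℝ) => J z.1 z.2)
    (volume.restrict (cube d ℓ ×ˢ cube d ℓ))

/-- Essential infimum of `J` over `Ω × Ω`. -/
def kernelInf {d : ℕ} (ℓ : ℝ) (J : (Fin d → ℝ) → (Fin d → ℝ) → ℝ) : ℝ :=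
  essInf (fun z : (Fin d → ℝ) × (Fin d → ℝ) => J z.1 z.2)
    (volume.restrict (cube d ℓ ×ˢ cube d ℓ))

end

end NonlocalDiffusion

open NonlocalDiffusion

/-! The discrete operator is exactly the cell average of an integral operator with quantized kernel
and quantized data (`discreteOp_eq_cellMean_quantizedOp`), and the discrete reaction is an exact
average of `f`. One step of the scheme can therefore be compared with the cell averages of the
equation integrated over a time step, and three errors remain: the quantization of `J` and of the
values, of order `r` and `q`; the variation of `u` within a time step, of order `τ` by Lipschitz
continuity in time; and the L¹ distance from `u(t_n)` to the step function of the scheme.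

The last distance is at most that from `u(t_n)` to its own cell means plus the discrete error `e n =
∑ h^d |mean of u(t_n) - u^n|`. The first part is of order `h` by a Poincaré inequality for BV
functions (`integral_abs_sub_stepFun_cellMean_le`), obtained from the L¹ translation estimate on a
convex set (`setIntegral_abs_translate_sub_le_variation`), itself derived by duality from the
definition of the variation. The variation of `u(t)` is bounded uniformly in `t`
(`IsSolution.exists_variation_le`).

Since `A` and `f` are Lipschitz on the ranges involved, `sum_abs_error_step_le` leads to `e (n+1) ≤
e n + τ (c e n + C (τ+h+q+r))`, and the discrete Grönwall inequality concludes. The local Lipschitz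
constant of `f` is uniform because the scheme stays bounded (`abs_scheme_le`). Its values may leave
`[Cm, CM]`, which `IsNearestIndex.abs_sub_mesh_le` tolerates at the price of a factor 2. -/

namespace NonlocalDiffusion

/-! ### The L¹ norm by duality with test functions -/

section Duality

variable {E : Type*} [NormedAddCommGroup E] [NormedSpace ℝ E] [FiniteDimensional ℝ E]
  [MeasurableSpace E] [BorelSpace E] {μ : Measure E} [μ.IsAddHaarMeasure]

/-- Bound on the mollification of a function with values in `[-1, 1]`. -/
lemma abs_convolution_normed_le_one (φ : ContDiffBump (0 : E)) {σ : E → ℝ}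
    (hσ : ∀ x, |σ x| ≤ 1) (x : E) :
    |convolution (φ.normed μ) σ (ContinuousLinearMap.lsmul ℝ ℝ) μ x| ≤ 1 := by
  rw [convolution_def, ← Real.norm_eq_abs]
  calc ‖∫ t, (ContinuousLinearMap.lsmul ℝ ℝ) (φ.normed μ t) (σ (x - t)) ∂μ‖
      ≤ ∫ t, φ.normed μ t ∂μ := by
        refine norm_integral_le_of_norm_le φ.integrable_normed (Eventually.of_forall fun t => ?_)
        simp only [ContinuousLinearMap.lsmul_apply, smul_eq_mul, norm_mul, Real.norm_eq_abs]
        rw [abs_of_nonneg (φ.nonneg_normed t)]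
        exact mul_le_of_le_one_right (φ.nonneg_normed t) (hσ _)
    _ = 1 := φ.integral_normed

/-- The ideal test function is the sign of `F` cut off to `K`. Its mollifications are admissible
once the scale is below the room between `K` and the complement of `W`; they converge a.e. and are
bounded by 1, so dominated convergence applies. -/
lemma setIntegral_abs_le_of_forall_test_of_isCompact {F : E → ℝ} (hF : Integrable F μ) {W K : Set E}
    (hW : IsOpen W) (hK : IsCompact K) (hKW : K ⊆ W) {M : ℝ}
    (h : ∀ ψ : E → ℝ, ContDiff ℝ 1 ψ → HasCompactSupport ψ → tsupport ψ ⊆ W →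
      (∀ x, |ψ x| ≤ 1) → ∫ x, F x * ψ x ∂μ ≤ M) :
    ∫ x in K, |F x| ∂μ ≤ M := by
  obtain ⟨δ, hδ, hδW⟩ := hK.exists_cthickening_subset_open hW hKW
  set σ : E → ℝ := K.indicator fun x => (SignType.sign (F x) : ℝ) with hσ
  have hσ1 : ∀ x, |σ x| ≤ 1 := by
    intro x
    by_cases hx : x ∈ K
    · simp only [hσ, indicator_of_mem hx]
      rcases lt_trichotomy (F x) 0 with h0 | h0 | h0 <;> simp [h0]
    · simp [hσ, hx]
  have hsign : Measurable fun y : ℝ => ((SignType.sign y : SignType) : ℝ) := by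
    have : (fun y : ℝ => ((SignType.sign y : SignType) : ℝ))
        = fun y => if 0 < y then 1 else if y < 0 then -1 else 0 := by
      ext y
      rcases lt_trichotomy y 0 with h0 | h0 | h0
      · simp [h0, not_lt.2 h0.le]
      · simp [h0]
      · simp [h0]
    rw [this]
    exact Measurable.ite measurableSet_Ioi measurable_const
      (Measurable.ite measurableSet_Iio measurable_const measurable_const)
  have hσm : AEStronglyMeasurable σ μ :=
    ((hsign.comp_aemeasurable hF.aemeasurable).indicator hK.measurableSet).aestronglyMeasurable
  have hσi : Integrable σ μ := by
    have h1 : IntegrableOn (fun x => (SignType.sign (F x) : ℝ)) K μ := by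
      refine Measure.integrableOn_of_bounded (M := 1) hK.measure_lt_top.ne
        (hsign.comp_aemeasurable hF.aemeasurable).aestronglyMeasurable
        (Eventually.of_forall fun x => ?_)
      rcases lt_trichotomy (F x) 0 with h0 | h0 | h0 <;> simp [h0]
    exact (integrable_indicator_iff hK.measurableSet).2 h1
  -- Outer radius `δ/(n+2)` keeps supports in the `δ`-thickening of `K`; the fixed ratio 2 of the
  -- radii is what a.e. convergence at Lebesgue points requires.
  let φ : ℕ → ContDiffBump (0 : E) := fun n =>
    ⟨δ / (2 * (n + 2)), δ / (n + 2), by positivity, by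
      apply div_lt_div_of_pos_left hδ (by positivity)
      have : (0 : ℝ) ≤ n := n.cast_nonneg
      linarith⟩
  have hφ0 : Tendsto (fun n => (φ n).rOut) atTop (𝓝 0) := by
    have : Tendsto (fun n : ℕ => δ / ((n : ℝ) + 2)) atTop (𝓝 0) :=
      Tendsto.div_atTop tendsto_const_nhds
        (tendsto_atTop_add_const_right _ _ tendsto_natCast_atTop_atTop)
    exact this
  have hφ1 : ∀ᶠ n in atTop, (φ n).rOut ≤ 2 * (φ n).rIn := by
    refine Eventually.of_forall fun n => le_of_eq ?_
    show δ / ((n : ℝ) + 2) = 2 * (δ / (2 * (n + 2)))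
    field_simp
  set ψ : ℕ → E → ℝ := fun n =>
    convolution ((φ n).normed μ) σ (ContinuousLinearMap.lsmul ℝ ℝ) μ with hψ
  have hlim : ∀ᵐ x ∂μ, Tendsto (fun n => ψ n x) atTop (𝓝 (σ x)) :=
    ContDiffBump.ae_convolution_tendsto_right_of_locallyIntegrable hφ0 hφ1 hσi.locallyIntegrable
  have hcont : ∀ n, ContDiff ℝ 1 (ψ n) := fun n =>
    (φ n).hasCompactSupport_normed.contDiff_convolution_left _
      (φ n).contDiff_normed hσi.locallyIntegrable
  have hsupp : ∀ n, tsupport (ψ n) ⊆ Metric.cthickening δ K := by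
    intro n
    refine closure_minimal ?_ Metric.isClosed_cthickening
    refine (support_convolution_subset _).trans ?_
    rintro _ ⟨a, ha, b, hb, rfl⟩
    have hbK : b ∈ K := by
      by_contra hb'
      exact hb (by simp [hσ, hb'])
    rw [(φ n).support_normed_eq] at ha
    refine Metric.mem_cthickening_of_dist_le _ b _ _ hbK ?_
    have h1 : ‖a‖ < δ / (n + 2) := by simpa using ha
    have h2 : δ / ((n : ℝ) + 2) ≤ δ := by
      apply div_le_self hδ.le
      have : (0 : ℝ) ≤ n := n.cast_nonneg
      linarith
    simp only [dist_eq_norm, add_sub_cancel_right]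
    linarith
  have hle : ∀ n, ∫ x, F x * ψ n x ∂μ ≤ M := fun n =>
    h _ (hcont n) (HasCompactSupport.intro' hK.cthickening Metric.isClosed_cthickening
      fun x hx => by
        by_contra h0
        exact hx (hsupp n (subset_tsupport _ h0))) ((hsupp n).trans hδW)
      (abs_convolution_normed_le_one (φ n) hσ1)
  have hT : Tendsto (fun n => ∫ x, F x * ψ n x ∂μ) atTop (𝓝 (∫ x, F x * σ x ∂μ)) := by
    refine tendsto_integral_of_dominated_convergence (fun x => ‖F x‖)
      (fun n => hF.1.mul (hcont n).continuous.aestronglyMeasurable) hF.norm (fun n => ?_) ?_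
    · refine Eventually.of_forall fun x => ?_
      rw [norm_mul]
      exact mul_le_of_le_one_right (norm_nonneg _)
        (abs_convolution_normed_le_one (φ n) hσ1 x)
    · filter_upwards [hlim] with x hx using hx.const_mul _
  have heq : ∫ x in K, |F x| ∂μ = ∫ x, F x * σ x ∂μ := by
    rw [← integral_indicator hK.measurableSet]
    congr 1
    ext x
    by_cases hx : x ∈ K
    · simp only [hσ, indicator_of_mem hx]
      exact (self_mul_sign (F x)).symm
    · simp [hσ, hx]
  rw [heq]
  exact le_of_tendsto' hT hle

/-- The `L¹` norm on an open set is determined by duality with compactly supported `C¹`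
functions. -/
lemma setIntegral_abs_le_of_forall_test {F : E → ℝ} (hF : Integrable F μ) {W : Set E}
    (hW : IsOpen W) {M : ℝ}
    (h : ∀ ψ : E → ℝ, ContDiff ℝ 1 ψ → HasCompactSupport ψ → tsupport ψ ⊆ W →
      (∀ x, |ψ x| ≤ 1) → ∫ x, F x * ψ x ∂μ ≤ M) :
    ∫ x in W, |F x| ∂μ ≤ M := by
  -- Exhaust `W` by an increasing sequence of compact sets.
  obtain ⟨C, hC, -, hCU, hCm⟩ := hW.exists_iUnion_isClosed
  let K : ℕ → Set E := fun n => C n ∩ Metric.closedBall 0 n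
  have hK : ∀ n, IsCompact (K n) := fun n =>
    (isCompact_closedBall _ _).inter_left (hC n)
  have hKm : Monotone K := fun m n hmn => inter_subset_inter (hCm hmn)
    (Metric.closedBall_subset_closedBall (by exact_mod_cast hmn))
  have hKU : ⋃ n, K n = W := by
    rw [← hCU]
    refine Subset.antisymm (iUnion_mono fun n => inter_subset_left) ?_
    intro x hx
    obtain ⟨n, hn⟩ := mem_iUnion.1 hx
    obtain ⟨m, hm⟩ := exists_nat_ge ‖x‖
    refine mem_iUnion.2 ⟨max n m, hCm (le_max_left _ _) hn, ?_⟩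
    rw [mem_closedBall_zero_iff]
    exact hm.trans (by exact_mod_cast le_max_right _ _)
  have hT := tendsto_setIntegral_of_monotone (μ := μ) (f := fun x => |F x|)
    (fun n => (hK n).measurableSet) hKm hF.abs.integrableOn
  rw [hKU] at hT
  exact le_of_tendsto' hT fun n =>
    setIntegral_abs_le_of_forall_test_of_isCompact hF hW (hK n)
      ((subset_iUnion K n).trans hKU.subset) h

end Duality

/-! ### Translation estimate for BV functions -/

section Translation

variable {d : ℕ}

lemma sum_mul_fderiv_dirs (ψ : (Fin d → ℝ) → ℝ) (x s : Fin d → ℝ) :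
    ∑ i, s i * fderiv ℝ ψ x (dirs d i) = fderiv ℝ ψ x s := by
  conv_rhs => rw [← Finset.univ_sum_single s]
  rw [map_sum]
  refine Finset.sum_congr rfl fun i _ => ?_
  have : (Pi.single i (s i) : Fin d → ℝ) = s i • dirs d i := by
    ext k
    by_cases hk : k = i
    · subst hk; simp [dirs]
    · simp [dirs, hk]
  rw [this, map_smul, smul_eq_mul]

/-- The field `ψ s / |s|` has Euclidean length at most one, and its divergence is the derivative of
`ψ` along `s`, divided by `|s|`. -/
lemma setIntegral_mul_fderiv_le_variation {U : Set (Fin d → ℝ)} {g ψ : (Fin d → ℝ) → ℝ}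
    (hg : variation (dirs d) U g < ∞) (hψ : ContDiff ℝ 1 ψ) (hψc : HasCompactSupport ψ)
    (hψU : tsupport ψ ⊆ U) (hψ1 : ∀ x, |ψ x| ≤ 1) (s : Fin d → ℝ) :
    ∫ x in U, g x * fderiv ℝ ψ x s ≤ √(∑ i, s i ^ 2) * (variation (dirs d) U g).toReal := by
  set ρ := √(∑ i, s i ^ 2) with hρ
  have hsum : 0 ≤ ∑ i, s i ^ 2 := Finset.sum_nonneg fun i _ => sq_nonneg _
  by_cases h0 : ρ = 0
  · have hs : s = 0 := by
      have h1 : ∑ i, s i ^ 2 = 0 := (Real.sqrt_eq_zero hsum).1 h0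
      ext i
      have := (Finset.sum_eq_zero_iff_of_nonneg fun i _ => sq_nonneg (s i)).1 h1 i
        (Finset.mem_univ _)
      simpa using this
    simp [hs, h0]
  have hρ0 : 0 < ρ := lt_of_le_of_ne (Real.sqrt_nonneg _) (Ne.symm h0)
  have hρ2 : ρ ^ 2 = ∑ i, s i ^ 2 := Real.sq_sqrt hsum
  have htest : IsTestField U fun i x => s i / ρ * ψ x := by
    refine ⟨fun i => contDiff_const.mul hψ, fun i => hψc.mul_left, fun i => ?_, fun x => ?_⟩
    · exact (tsupport_mul_subset_right (f := fun _ => s i / ρ)).trans hψU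
    · have : ∑ i, (s i / ρ * ψ x) ^ 2 = (∑ i, s i ^ 2) / ρ ^ 2 * ψ x ^ 2 := by
        rw [Finset.sum_div, Finset.sum_mul]
        exact Finset.sum_congr rfl fun i _ => by ring
      rw [this, ← hρ2, div_self (by positivity), one_mul, sq_le_one_iff_abs_le_one]
      exact hψ1 x
  have hdiv : ∀ x, ∑ i, fderiv ℝ (fun x => s i / ρ * ψ x) x (dirs d i)
      = ρ⁻¹ * fderiv ℝ ψ x s := by
    intro x
    rw [← sum_mul_fderiv_dirs, Finset.mul_sum]
    refine Finset.sum_congr rfl fun i _ => ?_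
    rw [fderiv_const_mul (hψ.differentiable one_ne_zero x)]
    simp only [smul_apply, smul_eq_mul]
    ring
  have hle : ENNReal.ofReal (∫ x in U, g x * (ρ⁻¹ * fderiv ℝ ψ x s))
      ≤ variation (dirs d) U g := by
    simp_rw [← hdiv]
    exact le_iSup₂ (f := fun (φ : Fin d → (Fin d → ℝ) → ℝ) (_ : IsTestField U φ) =>
      ENNReal.ofReal (∫ x in U, g x * ∑ i, fderiv ℝ (φ i) x (dirs d i))) _ htest
  have h2 := (ENNReal.ofReal_le_iff_le_toReal hg.ne).1 hle
  have h3 : ∫ x in U, g x * (ρ⁻¹ * fderiv ℝ ψ x s)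
      = ρ⁻¹ * ∫ x in U, g x * fderiv ℝ ψ x s := by
    rw [← integral_const_mul]
    exact integral_congr_ae (Eventually.of_forall fun x => by simp only; ring)
  rw [h3] at h2
  calc ∫ x in U, g x * fderiv ℝ ψ x s = ρ * (ρ⁻¹ * ∫ x in U, g x * fderiv ℝ ψ x s) := by
        field_simp
    _ ≤ _ := mul_le_mul_of_nonneg_left h2 hρ0.le

lemma abs_setIntegral_mul_fderiv_le_variation {U : Set (Fin d → ℝ)} {g ψ : (Fin d → ℝ) → ℝ}
    (hg : variation (dirs d) U g < ∞) (hψ : ContDiff ℝ 1 ψ) (hψc : HasCompactSupport ψ)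
    (hψU : tsupport ψ ⊆ U) (hψ1 : ∀ x, |ψ x| ≤ 1) (s : Fin d → ℝ) :
    |∫ x in U, g x * fderiv ℝ ψ x s| ≤ √(∑ i, s i ^ 2) * (variation (dirs d) U g).toReal := by
  refine abs_le.2 ⟨?_, setIntegral_mul_fderiv_le_variation hg hψ hψc hψU hψ1 s⟩
  have h := setIntegral_mul_fderiv_le_variation hg hψ hψc hψU hψ1 (-s)
  have h2 : ∫ x in U, g x * fderiv ℝ ψ x (-s) = -∫ x in U, g x * fderiv ℝ ψ x s := by
    rw [← integral_neg]
    exact integral_congr_ae (Eventually.of_forall fun x => by simp)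
  simp only [h2, Pi.neg_apply, neg_sq] at h
  linarith

/-- Slide the test function along the segment `θ s`, `0 ≤ θ ≤ 1`: the pairing with `g` has as
derivative a pairing with a directional derivative, bounded by the variation as long as the moving
support stays in `U`. Convexity of `U` ensures that it does. -/
lemma setIntegral_mul_translate_sub_le_variation {U : Set (Fin d → ℝ)} (hU : Convex ℝ U)
    {g ψ : (Fin d → ℝ) → ℝ} (hgi : IntegrableOn g U)
    (hg : variation (dirs d) U g < ∞) (hψ : ContDiff ℝ 1 ψ) (hψc : HasCompactSupport ψ)
    (s : Fin d → ℝ) (hψU : ∀ x ∈ tsupport ψ, x ∈ U ∧ x + s ∈ U) (hψ1 : ∀ x, |ψ x| ≤ 1) :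
    |(∫ x in U, g x * ψ (x - s)) - ∫ x in U, g x * ψ x|
      ≤ √(∑ i, s i ^ 2) * (variation (dirs d) U g).toReal := by
  have hfc : Continuous (fderiv ℝ ψ) := hψ.continuous_fderiv one_ne_zero
  obtain ⟨B, hB⟩ := (hψc.fderiv (𝕜 := ℝ)).exists_bound_of_continuous hfc
  have hB0 : 0 ≤ B := (norm_nonneg _).trans (hB 0)
  have hsmul : ∀ θ : ℝ, Continuous fun x : Fin d → ℝ => ψ (x - θ • s) := fun θ =>
    hψ.continuous.comp (continuous_id.sub continuous_const)
  have hint : ∀ θ : ℝ, IntegrableOn (fun x => g x * ψ (x - θ • s)) U := fun θ =>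
    hgi.mul_bdd (c := 1) (hsmul θ).aestronglyMeasurable (Eventually.of_forall fun x => hψ1 _)
  have hderψ : ∀ (x : Fin d → ℝ) (θ : ℝ),
      HasDerivAt (fun θ : ℝ => ψ (x - θ • s)) (-(fderiv ℝ ψ (x - θ • s) s)) θ := by
    intro x θ
    have h1 : HasDerivAt (fun θ : ℝ => x - θ • s) (-s) θ := by
      simpa using ((hasDerivAt_id θ).smul_const s).const_sub x
    have h2 := (hψ.differentiable one_ne_zero (x - θ • s)).hasFDerivAt.comp_hasDerivAt θ h1
    rw [map_neg] at h2
    exact h2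
  have hder : ∀ θ : ℝ, HasDerivAt (fun θ : ℝ => ∫ x in U, g x * ψ (x - θ • s))
      (∫ x in U, g x * -(fderiv ℝ ψ (x - θ • s) s)) θ := by
    intro θ
    refine (hasDerivAt_integral_of_dominated_loc_of_deriv_le (μ := volume.restrict U)
      (F := fun θ x => g x * ψ (x - θ • s))
      (F' := fun θ x => g x * -(fderiv ℝ ψ (x - θ • s) s)) (s := univ)
      (bound := fun x => ‖g x‖ * (B * ‖s‖)) univ_mem
      (Eventually.of_forall fun θ => (hint θ).1) (hint θ) ?_ ?_ ?_ ?_).2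
    · refine hgi.1.mul (Continuous.aestronglyMeasurable ?_)
      exact ((hfc.comp (continuous_id.sub continuous_const)).clm_apply continuous_const).neg
    · refine Eventually.of_forall fun x θ _ => ?_
      rw [norm_mul, norm_neg]
      refine mul_le_mul_of_nonneg_left ?_ (norm_nonneg _)
      exact (ContinuousLinearMap.le_opNorm _ _).trans
        (mul_le_mul_of_nonneg_right (hB _) (norm_nonneg _))
    · exact hgi.norm.mul_const _
    · exact Eventually.of_forall fun x θ _ => (hderψ x θ).const_mul (g x)
  have hbound : ∀ θ ∈ Ico (0 : ℝ) 1, ‖∫ x in U, g x * -(fderiv ℝ ψ (x - θ • s) s)‖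
      ≤ √(∑ i, s i ^ 2) * (variation (dirs d) U g).toReal := by
    intro θ hθ
    have hemb : Topology.IsClosedEmbedding fun x : Fin d → ℝ => x - θ • s :=
      (Homeomorph.subRight (θ • s)).isClosedEmbedding
    have hts : tsupport (fun x => ψ (x - θ • s)) ⊆ U := by
      intro x hx
      have hx' : x - θ • s ∈ tsupport ψ :=
        (tsupport_comp_subset_preimage ψ (f := fun x : Fin d → ℝ => x - θ • s)
          (continuous_id.sub continuous_const)) hx
      obtain ⟨h1, h2⟩ := hψU _ hx'
      -- The point `x` is the combination of `x - θ s` and `x - θ s + s` with weights `1 - θ` and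
      -- `θ`.
      have := hU h1 h2 (sub_nonneg.2 hθ.2.le) hθ.1 (by ring)
      convert this using 1
      module
    have h := abs_setIntegral_mul_fderiv_le_variation hg
      (ψ := fun x => ψ (x - θ • s)) (hψ.comp (contDiff_id.sub contDiff_const))
      (hψc.comp_isClosedEmbedding hemb) hts (fun x => hψ1 _) s
    simp_rw [fderiv_comp_sub] at h
    rw [Real.norm_eq_abs]
    simp_rw [mul_neg]
    rw [integral_neg, abs_neg]
    exact h
  have := norm_image_sub_le_of_norm_deriv_le_segment_01'
    (fun θ _ => (hder θ).hasDerivWithinAt) hbound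
  simpa using this

/-- Translation estimate for functions of bounded variation on a convex open set. -/
lemma setIntegral_abs_translate_sub_le_variation {U : Set (Fin d → ℝ)} (hU : Convex ℝ U)
    (hUo : IsOpen U) {g : (Fin d → ℝ) → ℝ} (hgi : Integrable g)
    (hg : variation (dirs d) U g < ∞) (s : Fin d → ℝ) :
    ∫ x in U ∩ {x | x + s ∈ U}, |g (x + s) - g x|
      ≤ √(∑ i, s i ^ 2) * (variation (dirs d) U g).toReal := by
  have hWo : IsOpen (U ∩ {x | x + s ∈ U}) :=
    hUo.inter (hUo.preimage (continuous_id.add continuous_const))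
  have hgs : Integrable fun x => g (x + s) := hgi.comp_add_right s
  refine setIntegral_abs_le_of_forall_test (hgs.sub hgi) hWo fun ψ hψ hψc hψU hψ1 => ?_
  have hψb : ∀ᵐ x : Fin d → ℝ, ‖ψ x‖ ≤ 1 := Eventually.of_forall hψ1
  have hz : ∀ x, x ∉ U ∩ {x | x + s ∈ U} → ψ x = 0 := fun x hx => by
    by_contra h0
    exact hx (hψU (subset_tsupport _ h0))
  have h1 : ∫ x, (g (x + s) - g x) * ψ x = (∫ x, g (x + s) * ψ x) - ∫ x, g x * ψ x := by
    simp_rw [sub_mul]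
    exact integral_sub (hgs.mul_bdd hψ.continuous.aestronglyMeasurable hψb)
      (hgi.mul_bdd hψ.continuous.aestronglyMeasurable hψb)
  -- The translation moves onto the test function; restricting to `U` loses nothing, since `ψ (x -
  -- s) ≠ 0` forces `x = (x - s) + s` into `U`.
  have h2 : ∫ x, g (x + s) * ψ x = ∫ x in U, g x * ψ (x - s) := by
    rw [setIntegral_eq_integral_of_forall_compl_eq_zero]
    · rw [← integral_add_right_eq_self (fun x => g x * ψ (x - s)) s]
      simp
    · intro x hx
      rw [hz (x - s) (fun h => hx (by simpa using h.2)), mul_zero]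
  have h3 : ∫ x, g x * ψ x = ∫ x in U, g x * ψ x := by
    rw [setIntegral_eq_integral_of_forall_compl_eq_zero]
    intro x hx
    rw [hz x (fun h => hx h.1), mul_zero]
  simp only [Pi.sub_apply]
  rw [h1, h2, h3]
  exact (le_abs_self _).trans (setIntegral_mul_translate_sub_le_variation hU hgi.integrableOn hg
    hψ hψc s (fun x hx => hψU hx) hψ1)

lemma sqrt_sum_sq_le_mul {s : Fin d → ℝ} {h : ℝ} (hs : ∀ i, |s i| ≤ h) :
    √(∑ i, s i ^ 2) ≤ d * h := by
  rcases Nat.eq_zero_or_pos d with rfl | hd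
  · simp
  have h0 : 0 ≤ h := (abs_nonneg _).trans (hs ⟨0, hd⟩)
  have hd1 : (1 : ℝ) ≤ d := by exact_mod_cast hd
  refine Real.sqrt_le_iff.2 ⟨by positivity, ?_⟩
  calc ∑ i, s i ^ 2 ≤ ∑ _i : Fin d, h ^ 2 := Finset.sum_le_sum fun i _ =>
        sq_le_sq' (abs_le.1 (hs i)).1 (abs_le.1 (hs i)).2
    _ = d * h ^ 2 := by simp
    _ ≤ (d * h) ^ 2 := by nlinarith [sq_nonneg h]

end Translation

/-! ### Elementary properties of the variation -/

section Variation

variable {ι V : Type*} [Fintype ι] [NormedAddCommGroup V] [NormedSpace ℝ V] [MeasureSpace V]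

lemma variation_congr_ae {e : ι → V} {U : Set V} {g g' : V → ℝ}
    (h : g =ᵐ[volume.restrict U] g') : variation e U g = variation e U g' := by
  unfold variation
  congr 1; ext φ; congr 1; ext _
  congr 1
  exact integral_congr_ae (h.mono fun x hx => by simp only [hx])

lemma variation_add_le [BorelSpace V] [SecondCountableTopology V] {e : ι → V} {U : Set V}
    {g g' : V → ℝ}
    (hg : IntegrableOn g U) (hg' : IntegrableOn g' U) :
    variation e U (fun x => g x + g' x) ≤ variation e U g + variation e U g' := by
  refine iSup₂_le fun φ hφ => ?_
  have hc : ∀ i, Continuous fun x => fderiv ℝ (φ i) x (e i) := fun i =>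
    ((hφ.contDiff i).continuous_fderiv one_ne_zero).clm_apply continuous_const
  -- A bounded divergence makes both products integrable, which splitting the integral requires.
  have hb : ∃ B, ∀ x, ‖∑ i, fderiv ℝ (φ i) x (e i)‖ ≤ B := by
    refine HasCompactSupport.exists_bound_of_continuous ?_ (continuous_finsetSum _ fun i _ => hc i)
    have : ∀ i, HasCompactSupport fun x => fderiv ℝ (φ i) x (e i) := fun i =>
      ((hφ.compact i).fderiv (𝕜 := ℝ)).comp_left
        (g := fun L : V →L[ℝ] ℝ => L (e i)) (by simp)
    refine HasCompactSupport.intro' (K := ⋃ i, tsupport fun x => fderiv ℝ (φ i) x (e i))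
      (isCompact_iUnion this) (isClosed_iUnion_of_finite fun i => isClosed_tsupport _)
      fun x hx => ?_
    refine Finset.sum_eq_zero fun i _ => ?_
    by_contra h0
    exact hx (mem_iUnion.2 ⟨i, subset_tsupport _ h0⟩)
  obtain ⟨B, hB⟩ := hb
  have hm : AEStronglyMeasurable (fun x => ∑ i, fderiv ℝ (φ i) x (e i)) (volume.restrict U) :=
    (continuous_finsetSum _ fun i _ => hc i).aestronglyMeasurable
  simp_rw [add_mul]
  rw [integral_add (hg.mul_bdd hm (Eventually.of_forall hB))
    (hg'.mul_bdd hm (Eventually.of_forall hB))]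
  refine ENNReal.ofReal_add_le.trans (add_le_add ?_ ?_)
  · exact le_iSup₂ (f := fun (φ : ι → V → ℝ) (_ : IsTestField U φ) =>
      ENNReal.ofReal (∫ x in U, g x * ∑ i, fderiv ℝ (φ i) x (e i))) φ hφ
  · exact le_iSup₂ (f := fun (φ : ι → V → ℝ) (_ : IsTestField U φ) =>
      ENNReal.ofReal (∫ x in U, g' x * ∑ i, fderiv ℝ (φ i) x (e i))) φ hφ

end Variation

/-! ### Geometry of the mesh -/

section Cells

variable {d M : ℕ}

lemma cell_eq_pi (h : ℝ) (j : Fin d → Fin M) :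
    cell h j = univ.pi fun k => Ioo ((j k : ℝ) * h) (((j k : ℝ) + 1) * h) := by
  ext x
  simp only [cell, mem_ofPred_eq, Set.mem_pi, mem_univ, true_implies, mem_Ioo, abs_lt]
  refine forall_congr' fun k => and_congr ?_ ?_ <;> constructor <;> intro _ <;> linarith

lemma cube_eq_pi (ℓ : ℝ) : cube d ℓ = univ.pi fun _ => Ioo 0 ℓ := by
  ext x
  simp [cube]

lemma measurableSet_cell (h : ℝ) (j : Fin d → Fin M) : MeasurableSet (cell h j) := by
  rw [cell_eq_pi]
  exact MeasurableSet.univ_pi fun k => measurableSet_Ioo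

lemma measurableSet_cube (ℓ : ℝ) : MeasurableSet (cube d ℓ) := by
  rw [cube_eq_pi]
  exact MeasurableSet.univ_pi fun k => measurableSet_Ioo

lemma isOpen_cube (ℓ : ℝ) : IsOpen (cube d ℓ) := by
  rw [cube_eq_pi]
  exact isOpen_set_pi finite_univ fun _ _ => isOpen_Ioo

lemma convex_cube (ℓ : ℝ) : Convex ℝ (cube d ℓ) := by
  rw [cube_eq_pi]
  exact convex_pi fun _ _ => convex_Ioo 0 ℓ

lemma volume_cell (h : ℝ) (j : Fin d → Fin M) :
    volume (cell h j) = ENNReal.ofReal h ^ d := by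
  rw [cell_eq_pi, volume_pi_pi]
  have : ∀ k, volume (Ioo ((j k : ℝ) * h) (((j k : ℝ) + 1) * h)) = ENNReal.ofReal h := by
    intro k
    rw [Real.volume_Ioo]
    congr 1
    ring
  simp [this]

lemma volume_cube (ℓ : ℝ) : volume (cube d ℓ) = ENNReal.ofReal ℓ ^ d := by
  rw [cube_eq_pi, volume_pi_pi]
  simp

lemma volume_real_cell {h : ℝ} (hh : 0 ≤ h) (j : Fin d → Fin M) :
    volume.real (cell h j) = h ^ d := by
  rw [Measure.real, volume_cell, ENNReal.toReal_pow, ENNReal.toReal_ofReal hh]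

lemma volume_real_cube {ℓ : ℝ} (hℓ : 0 ≤ ℓ) : volume.real (cube d ℓ) = ℓ ^ d := by
  rw [Measure.real, volume_cube, ENNReal.toReal_pow, ENNReal.toReal_ofReal hℓ]

instance isFiniteMeasure_restrict_cube (ℓ : ℝ) : IsFiniteMeasure (volume.restrict (cube d ℓ)) :=
  ⟨by rw [Measure.restrict_apply_univ, volume_cube]; exact ENNReal.pow_lt_top ENNReal.ofReal_lt_top⟩

instance isFiniteMeasure_restrict_cell (h : ℝ) (j : Fin d → Fin M) :
    IsFiniteMeasure (volume.restrict (cell h j)) :=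
  ⟨by rw [Measure.restrict_apply_univ, volume_cell]; exact ENNReal.pow_lt_top ENNReal.ofReal_lt_top⟩

lemma eq_of_mem_cell {h : ℝ} (hh : 0 < h) {i j : Fin d → Fin M} {x : Fin d → ℝ}
    (hi : x ∈ cell h i) (hj : x ∈ cell h j) : i = j := by
  rw [cell_eq_pi] at hi hj
  ext k
  have h1 := hi k (mem_univ _)
  have h2 := hj k (mem_univ _)
  have h3 : (i k : ℝ) < (j k : ℝ) + 1 := lt_of_mul_lt_mul_right (h1.1.trans h2.2) hh.le
  have h4 : (j k : ℝ) < (i k : ℝ) + 1 := lt_of_mul_lt_mul_right (h2.1.trans h1.2) hh.le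
  norm_cast at h3 h4
  omega

lemma pairwise_disjoint_cell {h : ℝ} (hh : 0 < h) :
    Pairwise (Function.onFun Disjoint fun j : Fin d → Fin M => cell h j) := fun _ _ hij =>
  Set.disjoint_left.2 fun _ hi hj => hij (eq_of_mem_cell hh hi hj)

lemma cell_subset_cube {ℓ h : ℝ} (hh : 0 < h) (hM : M * h = ℓ) (j : Fin d → Fin M) :
    cell h j ⊆ cube d ℓ := by
  intro x hx k
  rw [cell_eq_pi] at hx
  have h1 := hx k (mem_univ _)
  refine ⟨lt_of_le_of_lt (by positivity) h1.1, h1.2.trans_le ?_⟩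
  rw [← hM]
  refine mul_le_mul_of_nonneg_right ?_ hh.le
  exact_mod_cast (j k).isLt

/-- The `M^d` disjoint cells of volume `h^d` lie in the cube and already account for its volume
`ℓ^d`. -/
lemma iUnion_cell_ae_eq_cube {ℓ h : ℝ} (hh : 0 < h) (hM : M * h = ℓ) :
    (⋃ j : Fin d → Fin M, cell h j) =ᵐ[volume] cube d ℓ := by
  refine ae_eq_of_subset_of_measure_ge (iUnion_subset fun j => cell_subset_cube hh hM j) ?_
    (MeasurableSet.iUnion fun j => measurableSet_cell h j).nullMeasurableSet ?_
  · rw [measure_iUnion (pairwise_disjoint_cell hh) fun j => measurableSet_cell h j]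
    simp_rw [volume_cell]
    rw [tsum_fintype, Finset.sum_const, volume_cube, ← hM]
    simp only [Finset.card_univ, Fintype.card_pi, Fintype.card_fin, Finset.prod_const,
      nsmul_eq_mul]
    rw [ENNReal.ofReal_mul (by positivity), mul_pow]
    simp
  · rw [volume_cube]
    exact (ENNReal.pow_lt_top ENNReal.ofReal_lt_top).ne

lemma restrict_iUnion_cell {ℓ h : ℝ} (hh : 0 < h) (hM : M * h = ℓ) :
    volume.restrict (⋃ j : Fin d → Fin M, cell h j) = volume.restrict (cube d ℓ) :=
  Measure.restrict_congr_set (iUnion_cell_ae_eq_cube hh hM)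

lemma ae_cube_exists_mem_cell {ℓ h : ℝ} (hh : 0 < h) (hM : M * h = ℓ) :
    ∀ᵐ x ∂(volume.restrict (cube d ℓ)), ∃ j : Fin d → Fin M, x ∈ cell h j := by
  rw [← restrict_iUnion_cell hh hM]
  filter_upwards [ae_restrict_mem (MeasurableSet.iUnion fun j => measurableSet_cell h j)] with x hx
  exact mem_iUnion.1 hx

lemma ae_restrict_cell_of_cube {ℓ h : ℝ} (hh : 0 < h) (hM : M * h = ℓ) (j : Fin d → Fin M)
    {p : (Fin d → ℝ) → Prop} (hp : ∀ᵐ x ∂(volume.restrict (cube d ℓ)), p x) :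
    ∀ᵐ x ∂(volume.restrict (cell h j)), p x :=
  ae_restrict_of_ae_restrict_of_subset (cell_subset_cube hh hM j) hp

lemma lintegral_cube_eq_sum {ℓ h : ℝ} (hh : 0 < h) (hM : M * h = ℓ) (g : (Fin d → ℝ) → ℝ≥0∞) :
    ∫⁻ x in cube d ℓ, g x = ∑ j : Fin d → Fin M, ∫⁻ x in cell h j, g x := by
  rw [← restrict_iUnion_cell hh hM, lintegral_iUnion (fun j => measurableSet_cell h j)
    (pairwise_disjoint_cell hh), tsum_fintype]

lemma integral_cube_eq_sum {ℓ h : ℝ} (hh : 0 < h) (hM : M * h = ℓ) {g : (Fin d → ℝ) → ℝ}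
    (hg : IntegrableOn g (cube d ℓ)) :
    ∫ x in cube d ℓ, g x = ∑ j : Fin d → Fin M, ∫ x in cell h j, g x := by
  rw [← restrict_iUnion_cell hh hM, integral_iUnion_fintype (fun j => measurableSet_cell h j)
    (pairwise_disjoint_cell hh) fun j => hg.mono_set (cell_subset_cube hh hM j)]

lemma stepFun_of_mem_cell {h : ℝ} (hh : 0 < h) (v : (Fin d → Fin M) → ℝ) {j : Fin d → Fin M}
    {x : Fin d → ℝ} (hx : x ∈ cell h j) : stepFun h v x = v j := by
  rw [stepFun, Finset.sum_eq_single j]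
  · exact indicator_of_mem hx _
  · intro i _ hij
    exact indicator_of_notMem (fun hi => hij (eq_of_mem_cell hh hi hx)) _
  · simp

lemma measurable_stepFun (h : ℝ) (v : (Fin d → Fin M) → ℝ) : Measurable (stepFun h v) :=
  Finset.measurable_sum _ fun j _ => measurable_const.indicator (measurableSet_cell h j)

lemma abs_cellMean_sub_le {h : ℝ} (hh : 0 < h) {g : (Fin d → ℝ) → ℝ} (j : Fin d → Fin M)
    (hg : IntegrableOn g (cell h j)) (c B : ℝ)
    (hB : ∀ᵐ x ∂(volume.restrict (cell h j)), |g x - c| ≤ B) : |cellMean h g j - c| ≤ B := by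
  have hd : 0 < h ^ d := by positivity
  have h1 : cellMean h g j - c = 1 / h ^ d * ∫ x in cell h j, (g x - c) := by
    rw [integral_sub hg (integrable_const _), integral_const, measureReal_restrict_apply_univ,
      volume_real_cell hh.le, cellMean, smul_eq_mul]
    field_simp
  have h2 : ‖∫ x in cell h j, (g x - c)‖ ≤ B * h ^ d := by
    have := norm_setIntegral_le_of_norm_le_const_ae' (C := B)
      (f := fun x => g x - c) (s := cell h j) (μ := volume)
      (by rw [volume_cell]; exact ENNReal.pow_lt_top ENNReal.ofReal_lt_top)
      ((ae_restrict_iff' (measurableSet_cell h j)).1 hB)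
    rwa [volume_real_cell hh.le] at this
  rw [h1, abs_mul, abs_of_pos (by positivity : 0 < 1 / h ^ d), one_div, inv_mul_le_iff₀ hd]
  rw [Real.norm_eq_abs] at h2
  linarith

end Cells

/-! ### Poincaré inequality for cell averages -/

section Poincare

variable {d M : ℕ}

/-- Two points of one cell differ by a vector `s` of sup norm less than `h`. With Tonelli, the sum
is dominated by the translation estimate integrated over that ball of shifts, of volume `(2h)^d`. -/
lemma sum_lintegral_cell_le_variation {ℓ h : ℝ} (hh : 0 < h) (hM : M * h = ℓ)
    {g : (Fin d → ℝ) → ℝ} (hgm : Measurable g) (hgi : Integrable g)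
    (hg : variation (dirs d) (cube d ℓ) g < ∞) :
    ∑ j : Fin d → Fin M, ∫⁻ x in cell h j, ∫⁻ y in cell h j, ‖g x - g y‖ₑ
      ≤ ENNReal.ofReal ((2 * h) ^ d * (d * h * (variation (dirs d) (cube d ℓ) g).toReal)) := by
  set V := (variation (dirs d) (cube d ℓ) g).toReal with hV
  set Ω := cube d ℓ with hΩ
  have hΩm : MeasurableSet Ω := measurableSet_cube ℓ
  set H : (Fin d → ℝ) → (Fin d → ℝ) → ℝ≥0∞ := fun x s =>
    (Metric.ball (0 : Fin d → ℝ) h).indicator 1 s * (Ω.indicator 1 x * Ω.indicator 1 (x + s)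
      * ‖g (x + s) - g x‖ₑ) with hH
  have hHm : Measurable (Function.uncurry H) := by
    refine ((measurable_one.indicator Metric.isOpen_ball.measurableSet).comp measurable_snd).mul
      ((((measurable_one.indicator hΩm).comp measurable_fst).mul
        ((measurable_one.indicator hΩm).comp (measurable_fst.add measurable_snd))).mul ?_)
    exact ((hgm.comp (measurable_fst.add measurable_snd)).sub (hgm.comp measurable_fst)).enorm
  calc ∑ j : Fin d → Fin M, ∫⁻ x in cell h j, ∫⁻ y in cell h j, ‖g x - g y‖ₑ
      ≤ ∑ j : Fin d → Fin M, ∫⁻ x in cell h j, ∫⁻ s, H x s := by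
        refine Finset.sum_le_sum fun j _ => ?_
        refine setLIntegral_mono' (measurableSet_cell h j) fun x hx => ?_
        have h1 : ∫⁻ s, H x s = ∫⁻ y, H x (y - x) := by
          rw [lintegral_sub_right_eq_self (fun s => H x s) x]
        rw [h1, ← lintegral_indicator (measurableSet_cell h j)]
        refine lintegral_mono fun y => ?_
        by_cases hy : y ∈ cell h j
        · have hb : y - x ∈ Metric.ball (0 : Fin d → ℝ) h := by
            rw [mem_ball_zero_iff, pi_norm_lt_iff hh]
            intro k
            have h1 := abs_lt.1 (hx k)
            have h2 := abs_lt.1 (hy k)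
            rw [Real.norm_eq_abs, abs_lt, Pi.sub_apply]
            constructor <;> linarith
          have hxΩ : x ∈ Ω := cell_subset_cube hh hM j hx
          have hyΩ : y ∈ Ω := cell_subset_cube hh hM j hy
          simp only [hH, indicator_of_mem hy, indicator_of_mem hb, Pi.one_apply, one_mul,
            add_sub_cancel, indicator_of_mem hxΩ, indicator_of_mem hyΩ]
          rw [← enorm_neg, neg_sub]
        · simp [hy]
    _ = ∫⁻ x in Ω, ∫⁻ s, H x s := (lintegral_cube_eq_sum hh hM _).symm
    _ ≤ ∫⁻ x, ∫⁻ s, H x s := setLIntegral_le_lintegral _ _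
    _ = ∫⁻ s, ∫⁻ x, H x s := lintegral_lintegral_swap hHm.aemeasurable
    _ ≤ ∫⁻ s, (Metric.ball (0 : Fin d → ℝ) h).indicator
          (fun _ => ENNReal.ofReal (d * h * V)) s := by
        refine lintegral_mono fun s => ?_
        by_cases hs : s ∈ Metric.ball (0 : Fin d → ℝ) h
        · simp only [hH, indicator_of_mem hs, Pi.one_apply, one_mul]
          have hWm : MeasurableSet (Ω ∩ {x | x + s ∈ Ω}) :=
            hΩm.inter ((measurable_id.add_const s) hΩm)
          have h1 : ∀ x, Ω.indicator 1 x * Ω.indicator 1 (x + s) * ‖g (x + s) - g x‖ₑ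
              = (Ω ∩ {x | x + s ∈ Ω}).indicator (fun x => ‖g (x + s) - g x‖ₑ) x := by
            intro x
            by_cases hx : x ∈ Ω <;> by_cases hxs : x + s ∈ Ω <;> simp [indicator, hx, hxs]
          simp_rw [h1]
          rw [lintegral_indicator hWm]
          have h2 := setIntegral_abs_translate_sub_le_variation (convex_cube ℓ) (isOpen_cube ℓ)
            hgi hg s
          have h3 : Integrable fun x => g (x + s) - g x := (hgi.comp_add_right s).sub hgi
          rw [← ofReal_integral_norm_eq_lintegral_enorm h3.integrableOn]
          refine ENNReal.ofReal_le_ofReal (h2.trans ?_)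
          refine mul_le_mul_of_nonneg_right (sqrt_sum_sq_le_mul fun i => ?_) ENNReal.toReal_nonneg
          exact (norm_le_pi_norm s i).trans (mem_ball_zero_iff.1 hs).le
        · simp [hH, hs]
    _ = ENNReal.ofReal ((2 * h) ^ d * (d * h * V)) := by
        rw [lintegral_indicator Metric.isOpen_ball.measurableSet, setLIntegral_const,
          Real.volume_pi_ball _ hh, mul_comm, ← ENNReal.ofReal_mul (by positivity),
          Fintype.card_fin]

/-- Poincaré inequality: the `L¹` distance of a function of bounded variation to the step function
of its cell averages is of the order of the mesh size. -/
lemma integral_abs_sub_stepFun_cellMean_le {ℓ h : ℝ} (hh : 0 < h) (hM : M * h = ℓ)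
    {g : (Fin d → ℝ) → ℝ} (hg : MemBV (dirs d) (cube d ℓ) g) :
    ∫ x in cube d ℓ, |g x - stepFun h (cellMean (M := M) h g) x|
      ≤ 2 ^ d * d * h * (variation (dirs d) (cube d ℓ) g).toReal := by
  have hΩm : MeasurableSet (cube d ℓ) := measurableSet_cube ℓ
  have hgi : IntegrableOn g (cube d ℓ) := memLp_one_iff_integrable.1 hg.1
  have hGi : Integrable ((cube d ℓ).indicator g) := hgi.integrable_indicator hΩm
  -- A measurable representative on the whole space, as Tonelli and the shifts demand.
  set G := hGi.1.mk with hGdef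
  have hGG : (cube d ℓ).indicator g =ᵐ[volume] G := hGi.1.ae_eq_mk
  have hgG : g =ᵐ[volume.restrict (cube d ℓ)] G := by
    filter_upwards [ae_restrict_of_ae hGG, ae_restrict_mem hΩm] with x h1 h2
    rwa [indicator_of_mem h2] at h1
  have hGint : Integrable G := hGi.congr hGG
  have hvar := variation_congr_ae (e := dirs d) hgG
  have hmain := sum_lintegral_cell_le_variation hh hM hGi.1.stronglyMeasurable_mk.measurable hGint
    (hvar ▸ hg.2)
  rw [← hvar] at hmain
  have hd : 0 < h ^ d := by positivity
  have hmean : ∀ j : Fin d → Fin M, cellMean h g j = cellMean h G j := fun j => by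
    rw [cellMean, cellMean]
    congr 1
    exact integral_congr_ae (ae_restrict_cell_of_cube hh hM j hgG)
  have hcell : ∀ j : Fin d → Fin M,
      ∫⁻ x in cell h j, ‖g x - stepFun h (cellMean (M := M) h g) x‖ₑ
        ≤ ENNReal.ofReal (1 / h ^ d) * ∫⁻ x in cell h j, ∫⁻ y in cell h j, ‖G x - G y‖ₑ := by
    intro j
    rw [← lintegral_const_mul' _ _ ENNReal.ofReal_ne_top]
    refine lintegral_mono_ae ?_
    filter_upwards [ae_restrict_cell_of_cube hh hM j hgG,
      ae_restrict_mem (measurableSet_cell h j)] with x h1 h2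
    rw [stepFun_of_mem_cell hh _ h2, h1, hmean j]
    -- The deviation from the mean is the mean of the deviations, hence the double integral over the
    -- cell.
    have h3 : G x - cellMean h G j = 1 / h ^ d * ∫ y in cell h j, (G x - G y) := by
      rw [integral_sub (integrable_const _) hGint.integrableOn, integral_const,
        measureReal_restrict_apply_univ, volume_real_cell hh.le, cellMean, smul_eq_mul]
      field_simp
    rw [h3, enorm_mul, Real.enorm_of_nonneg (by positivity)]
    gcongr
    exact enorm_integral_le_lintegral_enorm _
  rw [integral_eq_lintegral_of_nonneg_ae
    (f := fun x => |g x - stepFun h (cellMean (M := M) h g) x|)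
    (Eventually.of_forall fun _ => abs_nonneg _)
    (hgi.1.sub (measurable_stepFun h _).aestronglyMeasurable).norm]
  refine ENNReal.toReal_le_of_le_ofReal (by positivity) ?_
  have hab : ∀ x, ENNReal.ofReal |g x - stepFun h (cellMean (M := M) h g) x|
      = ‖g x - stepFun h (cellMean (M := M) h g) x‖ₑ := fun x => by
    rw [← Real.norm_eq_abs, ofReal_norm]
  simp_rw [hab]
  rw [lintegral_cube_eq_sum hh hM]
  refine (Finset.sum_le_sum fun j _ => hcell j).trans ?_
  rw [← Finset.mul_sum]
  refine (mul_le_mul_right hmain _).trans ?_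
  rw [← ENNReal.ofReal_mul (by positivity)]
  refine ENNReal.ofReal_le_ofReal (le_of_eq ?_)
  rw [mul_pow]
  field_simp

end Poincare

/-! ### Quantization errors -/

section Quantization

lemma mesh_mem_Icc {K : ℕ} (hK : 1 ≤ K) {bot top step : ℝ} (hbt : bot ≤ top)
    (hstep : step = (top - bot) / K) (i : Fin (K + 1)) : mesh K top step i ∈ Icc bot top := by
  have hK0 : (0 : ℝ) < K := by exact_mod_cast hK
  have hs : 0 ≤ step := hstep ▸ div_nonneg (sub_nonneg.2 hbt) hK0.le
  have hi : (i : ℝ) ≤ K := by exact_mod_cast Nat.lt_succ_iff.1 i.isLt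
  have h1 : (K : ℝ) * step = top - bot := by rw [hstep]; field_simp
  have h2 : (i : ℝ) * step ≤ K * step := mul_le_mul_of_nonneg_right hi hs
  have h3 : 0 ≤ (i : ℝ) * step := by positivity
  exact ⟨by unfold mesh; linarith, by unfold mesh; linarith⟩

lemma exists_abs_sub_mesh_le {K : ℕ} (hK : 1 ≤ K) {bot top step w : ℝ}
    (hstep : step = (top - bot) / K) (hw : w ∈ Icc bot top) :
    ∃ i, |w - mesh K top step i| ≤ step := by
  have hK0 : (0 : ℝ) < K := by exact_mod_cast hK
  have hs : 0 ≤ step := hstep ▸ div_nonneg (sub_nonneg.2 (hw.1.trans hw.2)) hK0.le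
  have h1 : (K : ℝ) * step = top - bot := by rw [hstep]; field_simp
  rcases hs.eq_or_lt with h0 | h0
  -- With step zero the interval is a single point; otherwise the index is the integer part of `(top
  -- - w) / step`.
  · refine ⟨0, ?_⟩
    have : top = bot := by rw [← h0, mul_zero] at h1; linarith
    have h2 : w = top := le_antisymm hw.2 (this ▸ hw.1)
    simp [mesh, ← h0, h2]
  · have hx : 0 ≤ (top - w) / step := div_nonneg (sub_nonneg.2 hw.2) hs
    have hfl := Nat.floor_le hx
    have hfl2 := Nat.lt_floor_add_one ((top - w) / step)
    have hle : ⌊(top - w) / step⌋₊ ≤ K := by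
      refine Nat.floor_le_of_le ?_
      rw [div_le_iff₀ h0, h1]
      linarith [hw.1]
    refine ⟨⟨_, Nat.lt_succ_of_le hle⟩, ?_⟩
    rw [le_div_iff₀ h0] at hfl
    rw [div_lt_iff₀ h0] at hfl2
    simp only [mesh]
    rw [abs_le]
    constructor <;> linarith

/-- The point `ρ` may lie outside `[bot, top]`, as values of the scheme may. Its nearest mesh point
is no farther from `ρ` than the mesh point approximating `w`, and two triangle inequalities give the
factor 2. For `ρ = w` only `step` remains. -/
lemma IsNearestIndex.abs_sub_mesh_le {K : ℕ} (hK : 1 ≤ K) {bot top step w : ℝ}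
    (hstep : step = (top - bot) / K) (hw : w ∈ Icc bot top) {idx : ℝ → Fin (K + 1)}
    (hidx : IsNearestIndex (mesh K top step) idx) (ρ : ℝ) :
    |w - mesh K top step (idx ρ)| ≤ 2 * |w - ρ| + step := by
  obtain ⟨i, hi⟩ := exists_abs_sub_mesh_le hK hstep hw
  have h1 := abs_sub_le w ρ (mesh K top step (idx ρ))
  have h2 := hidx.2 ρ i
  have h3 := abs_sub_le ρ w (mesh K top step i)
  rw [abs_sub_comm ρ w] at h3
  linarith

end Quantization

/-! ### The discrete operator as a cell average -/

section DiscreteOp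

variable {d M KQ KR : ℕ}

/-- The nonlocal operator with quantized kernel and quantized data, at a point where the quantized
value of the data is `c`. -/
noncomputable def quantizedOp (ℓ h : ℝ) (J : (Fin d → ℝ) → (Fin d → ℝ) → ℝ) (A : ℝ → ℝ)
    (q : Fin (KQ + 1) → ℝ) (r : Fin (KR + 1) → ℝ)
    (idxQ : ℝ → Fin (KQ + 1)) (idxR : ℝ → Fin (KR + 1)) (v : (Fin d → Fin M) → ℝ) (c : ℝ)
    (x : Fin d → ℝ) : ℝ :=
  ∫ y in cube d ℓ, r (idxR (J x y)) * A (q (idxQ (stepFun h v y)) - c)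

lemma mem_levelSet_iff {h : ℝ} (hh : 0 < h) (idxQ : ℝ → Fin (KQ + 1))
    (v : (Fin d → Fin M) → ℝ) (i : Fin (KQ + 1)) {k : Fin d → Fin M} {y : Fin d → ℝ}
    (hy : y ∈ cell h k) : y ∈ levelSet h idxQ v i ↔ idxQ (stepFun h v y) = i := by
  rw [stepFun_of_mem_cell hh v hy, levelSet]
  simp only [mem_iUnion, mem_ofPred_eq, exists_prop]
  constructor
  · rintro ⟨k', hk', hy'⟩
    rw [← eq_of_mem_cell hh hy' hy]
    exact hk'
  · intro hk
    exact ⟨k, hk, hy⟩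

lemma levelSet_subset_cube {ℓ h : ℝ} (hh : 0 < h) (hM : M * h = ℓ) (idxQ : ℝ → Fin (KQ + 1))
    (v : (Fin d → Fin M) → ℝ) (i : Fin (KQ + 1)) : levelSet h idxQ v i ⊆ cube d ℓ :=
  iUnion₂_subset fun k _ => cell_subset_cube hh hM k

variable {ℓ h : ℝ} {J : (Fin d → ℝ) → (Fin d → ℝ) → ℝ}

lemma ae_ae_cube_of_ae_prod {p : (Fin d → ℝ) × (Fin d → ℝ) → Prop}
    (hp : ∀ᵐ z ∂(volume.restrict (cube d ℓ ×ˢ cube d ℓ)), p z) :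
    ∀ᵐ x ∂(volume.restrict (cube d ℓ)), ∀ᵐ y ∂(volume.restrict (cube d ℓ)), p (x, y) := by
  rw [Measure.volume_eq_prod, ← Measure.prod_restrict] at hp
  exact Measure.ae_ae_of_ae_prod hp

/-- Individual slices of an a.e. measurable kernel need not be measurable; those of a Borel
representative are, and they agree with `J x` for a.e. `x`. -/
lemma exists_measurable_kernel
    (hJ : AEStronglyMeasurable (fun z : (Fin d → ℝ) × (Fin d → ℝ) => J z.1 z.2)
      (volume.restrict (cube d ℓ ×ˢ cube d ℓ))) :
    ∃ J' : (Fin d → ℝ) × (Fin d → ℝ) → ℝ, Measurable J' ∧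
      ∀ᵐ x ∂(volume.restrict (cube d ℓ)), ∀ᵐ y ∂(volume.restrict (cube d ℓ)),
        J x y = J' (x, y) :=
  ⟨hJ.mk, hJ.stronglyMeasurable_mk.measurable, ae_ae_cube_of_ae_prod hJ.ae_eq_mk⟩

lemma abs_quantized_le (A : ℝ → ℝ) (q : Fin (KQ + 1) → ℝ) (r : Fin (KR + 1) → ℝ)
    (c : ℝ) (i : Fin (KQ + 1)) (m : Fin (KR + 1)) :
    |r m * A (q i - c)| ≤ (∑ m, |r m|) * ∑ i, |A (q i - c)| := by
  rw [abs_mul]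
  refine mul_le_mul
    (Finset.single_le_sum (f := fun m => |r m|) (fun _ _ => abs_nonneg _) (Finset.mem_univ m))
    (Finset.single_le_sum (f := fun i => |A (q i - c)|) (fun _ _ => abs_nonneg _)
      (Finset.mem_univ i)) (abs_nonneg _) (Finset.sum_nonneg fun _ _ => abs_nonneg _)

lemma integrableOn_quantizedOp
    (hJ : AEStronglyMeasurable (fun z : (Fin d → ℝ) × (Fin d → ℝ) => J z.1 z.2)
      (volume.restrict (cube d ℓ ×ˢ cube d ℓ))) (A : ℝ → ℝ)
    (q : Fin (KQ + 1) → ℝ) (r : Fin (KR + 1) → ℝ)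
    {idxQ : ℝ → Fin (KQ + 1)} {idxR : ℝ → Fin (KR + 1)}
    (hQ : Measurable idxQ) (hR : Measurable idxR) (v : (Fin d → Fin M) → ℝ) (c : ℝ) :
    IntegrableOn (quantizedOp ℓ h J A q r idxQ idxR v c) (cube d ℓ) := by
  obtain ⟨J', hJ', hJJ'⟩ := exists_measurable_kernel hJ
  have hmeas : Measurable fun z : (Fin d → ℝ) × (Fin d → ℝ) =>
      r (idxR (J' z)) * A (q (idxQ (stepFun h v z.2)) - c) :=
    ((measurable_of_finite r).comp (hR.comp hJ')).mul
      ((measurable_of_finite fun i => A (q i - c)).comp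
        (hQ.comp ((measurable_stepFun h v).comp measurable_snd)))
  have hsm := (hmeas.stronglyMeasurable.integral_prod_right'
    (ν := volume.restrict (cube d ℓ)))
  have hae : quantizedOp ℓ h J A q r idxQ idxR v c =ᵐ[volume.restrict (cube d ℓ)]
      fun x => ∫ y in cube d ℓ, r (idxR (J' (x, y))) * A (q (idxQ (stepFun h v y)) - c) := by
    filter_upwards [hJJ'] with x hx
    exact integral_congr_ae (hx.mono fun y hy => by simp only [hy])
  refine Integrable.of_bound (hsm.aestronglyMeasurable.congr hae.symm)
    (((∑ m, |r m|) * ∑ i, |A (q i - c)|) * (volume.restrict (cube d ℓ)).real univ)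
    (Eventually.of_forall fun x => ?_)
  exact norm_integral_le_of_norm_le_const
    (Eventually.of_forall fun y => abs_quantized_le A q r c _ _)

/-- The discrete operator is the cell average of the nonlocal operator with quantized kernel and
quantized data. -/
lemma discreteOp_eq_cellMean_quantizedOp (hh : 0 < h) (hM : M * h = ℓ)
    (hJ : AEStronglyMeasurable (fun z : (Fin d → ℝ) × (Fin d → ℝ) => J z.1 z.2)
      (volume.restrict (cube d ℓ ×ˢ cube d ℓ))) (A : ℝ → ℝ)
    (q : Fin (KQ + 1) → ℝ) (r : Fin (KR + 1) → ℝ)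
    {idxQ : ℝ → Fin (KQ + 1)} {idxR : ℝ → Fin (KR + 1)}
    (hQ : Measurable idxQ) (hR : Measurable idxR) (v : (Fin d → Fin M) → ℝ)
    (j : Fin d → Fin M) :
    discreteOp h J A q r idxQ idxR v j
      = cellMean h (quantizedOp ℓ h J A q r idxQ idxR v (q (idxQ (v j)))) j := by
  obtain ⟨J', hJ', hJJ'⟩ := exists_measurable_kernel hJ
  set c := q (idxQ (v j)) with hc
  let S : Fin (KQ + 1) → Fin (KR + 1) → Set ((Fin d → ℝ) × (Fin d → ℝ)) := fun i m =>
    {z | idxQ (stepFun h v z.2) = i ∧ idxR (J' z) = m}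
  have hS : ∀ i m, MeasurableSet (S i m) := fun i m =>
    ((hQ.comp ((measurable_stepFun h v).comp measurable_snd)) (measurableSet_singleton i)).inter
      ((hR.comp hJ') (measurableSet_singleton m))
  -- The passage to slices of the measurable sets `S i m` ignores the null set outside the cells and
  -- a null set of `y`.
  have hlev : ∀ᵐ x ∂(volume.restrict (cube d ℓ)), ∀ i m,
      levelMeasure h J idxQ idxR v i m x
        = (volume.restrict (cube d ℓ)).real (Prod.mk x ⁻¹' S i m) := by
    filter_upwards [hJJ'] with x hx i m
    rw [levelMeasure, Measure.real, Measure.real,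
      ← Measure.restrict_eq_self volume
        (fun y (hy : y ∈ {y | y ∈ levelSet h idxQ v i ∧ idxR (J x y) = m}) =>
          levelSet_subset_cube hh hM idxQ v i hy.1)]
    congr 1
    refine measure_congr ?_
    filter_upwards [hx, ae_cube_exists_mem_cell hh hM] with y hy hcell
    obtain ⟨k, hk⟩ := hcell
    refine propext ?_
    show (y ∈ levelSet h idxQ v i ∧ idxR (J x y) = m)
      ↔ (idxQ (stepFun h v y) = i ∧ idxR (J' (x, y)) = m)
    rw [mem_levelSet_iff hh idxQ v i hk, hy]
  have hint : ∀ i m, IntegrableOn (levelMeasure h J idxQ idxR v i m) (cell h j) := by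
    intro i m
    have h1 : AEStronglyMeasurable (levelMeasure h J idxQ idxR v i m)
        (volume.restrict (cell h j)) := by
      refine (Measurable.aestronglyMeasurable
        (f := fun x => (volume.restrict (cube d ℓ)).real (Prod.mk x ⁻¹' S i m)) ?_).congr ?_
      · exact (measurable_measure_prodMk_left (hS i m)).ennreal_toReal
      · filter_upwards [ae_restrict_cell_of_cube hh hM j hlev] with x hx
        exact (hx i m).symm
    refine Integrable.of_bound h1 ((volume.restrict (cube d ℓ)).real univ) ?_
    filter_upwards [ae_restrict_cell_of_cube hh hM j hlev] with x hx
    rw [hx i m, Real.norm_of_nonneg measureReal_nonneg]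
    exact measureReal_mono (subset_univ _)
  have hptw : ∀ᵐ x ∂(volume.restrict (cell h j)),
      quantizedOp ℓ h J A q r idxQ idxR v c x
        = ∑ i, A (q i - c) * ∑ m, r m * levelMeasure h J idxQ idxR v i m x := by
    filter_upwards [ae_restrict_cell_of_cube hh hM j hlev,
      ae_restrict_cell_of_cube hh hM j hJJ'] with x hx hxJ
    have hSx : ∀ i m, MeasurableSet (Prod.mk x ⁻¹' S i m) := fun i m =>
      measurable_prodMk_left (hS i m)
    have hi1 : ∀ i m, Integrable ((Prod.mk x ⁻¹' S i m).indicator (1 : (Fin d → ℝ) → ℝ))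
        (volume.restrict (cube d ℓ)) := fun i m =>
      (integrable_const (1 : ℝ)).indicator (hSx i m)
    have h1 : ∀ i m, levelMeasure h J idxQ idxR v i m x
        = ∫ y in cube d ℓ, (Prod.mk x ⁻¹' S i m).indicator 1 y := fun i m => by
      rw [hx i m, integral_indicator_one (hSx i m)]
    simp_rw [h1, ← integral_const_mul]
    rw [quantizedOp]
    have h2 : ∀ i, ∑ m, ∫ y in cube d ℓ, r m * (Prod.mk x ⁻¹' S i m).indicator 1 y
        = ∫ y in cube d ℓ, ∑ m, r m * (Prod.mk x ⁻¹' S i m).indicator 1 y := fun i =>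
      (integral_finsetSum _ fun m _ => (hi1 i m).const_mul (r m)).symm
    simp_rw [h2, ← integral_const_mul]
    rw [← integral_finsetSum _ fun i _ => Integrable.const_mul
      (integrable_finsetSum _ fun m _ => (hi1 i m).const_mul (r m)) _]
    refine integral_congr_ae (hxJ.mono fun y hy => ?_)
    simp only [hy]
    -- The slices partition the cube by pairs of indices, so each `y` contributes to one term only.
    rw [Finset.sum_eq_single (idxQ (stepFun h v y)), Finset.sum_eq_single (idxR (J' (x, y)))]
    · rw [indicator_of_mem (show y ∈ Prod.mk x ⁻¹' S _ _ from ⟨rfl, rfl⟩)]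
      simp [mul_comm]
    · intro m _ hm
      rw [indicator_of_notMem (fun hy : y ∈ Prod.mk x ⁻¹' S _ _ => hm hy.2.symm), mul_zero]
    · simp
    · intro i _ hi
      refine mul_eq_zero_of_right _ (Finset.sum_eq_zero fun m _ => ?_)
      rw [indicator_of_notMem (fun hy : y ∈ Prod.mk x ⁻¹' S _ _ => hi hy.1.symm), mul_zero]
    · simp
  rw [cellMean, integral_congr_ae hptw, integral_finsetSum _ fun i _ => Integrable.const_mul
      (integrable_finsetSum _ fun m _ => (hint i m).const_mul (r m)) _, discreteOp, Finset.mul_sum]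
  refine Finset.sum_congr rfl fun i _ => ?_
  rw [integral_const_mul, integral_finsetSum _ fun m _ => (hint i m).const_mul (r m)]
  simp_rw [integral_const_mul, cellMean]
  rw [← hc, mul_left_comm]
  congr 1
  rw [Finset.mul_sum]
  exact Finset.sum_congr rfl fun m _ => by ring

end DiscreteOp

/-! ### Grönwall, integration in time, integrability -/

section Auxiliary

/-- Discrete Grönwall inequality. -/
lemma discrete_gronwall_le {e : ℕ → ℝ} {a b c τ : ℝ} (hτ : 0 ≤ τ) (hb : 0 ≤ b) (hc : 0 ≤ c)
    (ha : 0 ≤ a) (h0 : e 0 ≤ a) {N : ℕ} (h : ∀ n < N, e (n + 1) ≤ e n + τ * (c * e n + b))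
    {n : ℕ} (hn : n ≤ N) : e n ≤ (a + n * τ * b) * Real.exp (c * (n * τ)) := by
  induction n with
  | zero => simpa using h0
  | succ n ih =>
    have ih := ih (by omega)
    have h1 := h n (by omega)
    have h2 : 1 + c * τ ≤ Real.exp (c * τ) := by linarith [Real.add_one_le_exp (c * τ)]
    have h3 : Real.exp (c * ((n + 1 : ℕ) * τ)) = Real.exp (c * (n * τ)) * Real.exp (c * τ) := by
      rw [← Real.exp_add]; congr 1; push_cast; ring
    have h4 : 1 ≤ Real.exp (c * ((n + 1 : ℕ) * τ)) := Real.one_le_exp (by positivity)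
    have h5 : 0 ≤ (a + n * τ * b) * Real.exp (c * (n * τ)) := by positivity
    calc e (n + 1) ≤ e n * (1 + c * τ) + τ * b := by linarith
      _ ≤ (a + n * τ * b) * Real.exp (c * (n * τ)) * (1 + c * τ) + τ * b := by gcongr
      _ ≤ (a + n * τ * b) * Real.exp (c * (n * τ)) * Real.exp (c * τ)
          + τ * b * Real.exp (c * ((n + 1 : ℕ) * τ)) :=
          add_le_add (mul_le_mul_of_nonneg_left h2 h5)
            (le_mul_of_one_le_right (by positivity) h4)
      _ = (a + (n + 1 : ℕ) * τ * b) * Real.exp (c * ((n + 1 : ℕ) * τ)) := by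
          rw [h3]; push_cast; ring

/-- A Lipschitz function is absolutely continuous, hence the integral of its derivative. Working
with `deriv φ` avoids any measurability requirement on `F`. -/
lemma abs_sub_sub_integral_le_of_ae_hasDerivAt {φ F g : ℝ → ℝ} {a b B : ℝ} {K : ℝ≥0} (hab : a ≤ b)
    (hφ : LipschitzOnWith K φ (Icc a b))
    (hder : ∀ᵐ t ∂(volume.restrict (Ioc a b)), HasDerivAt φ (F t) t)
    (hg : IntegrableOn g (Ioc a b))
    (hB : ∀ᵐ t ∂(volume.restrict (Ioc a b)), |F t - g t| ≤ B) :
    |φ b - φ a - ∫ t in a..b, g t| ≤ B * (b - a) := by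
  rw [← uIcc_of_le hab] at hφ
  have hac := hφ.absolutelyContinuousOnInterval
  have hgi : IntervalIntegrable g volume a b := (intervalIntegrable_iff_integrableOn_Ioc_of_le hab).2 hg
  rw [← hac.integral_deriv_eq_sub, ← intervalIntegral.integral_sub hac.intervalIntegrable_deriv hgi]
  have := intervalIntegral.norm_integral_le_of_norm_le_const_ae (a := a) (b := b) (C := B)
    (f := fun t => deriv φ t - g t) (by
      rw [uIoc_of_le hab]
      refine (ae_restrict_iff' measurableSet_Ioc).1 ?_
      filter_upwards [hder, hB] with t h1 h2
      rw [h1.deriv]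
      exact h2)
  rwa [abs_of_nonneg (sub_nonneg.2 hab)] at this

variable {d : ℕ} {T ℓ : ℝ}

lemma ae_ae_time_of_timeSpace {p : ℝ × (Fin d → ℝ) → Prop}
    (hp : ∀ᵐ z ∂(volume.restrict (timeSpace d T ℓ)), p z) :
    ∀ᵐ t ∂(volume.restrict (Ioo 0 T)), ∀ᵐ x ∂(volume.restrict (cube d ℓ)), p (t, x) := by
  rw [timeSpace, Measure.volume_eq_prod, ← Measure.prod_restrict] at hp
  exact Measure.ae_ae_of_ae_prod hp

lemma ae_ae_space_of_timeSpace {p : ℝ × (Fin d → ℝ) → Prop}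
    (hp : ∀ᵐ z ∂(volume.restrict (timeSpace d T ℓ)), p z) :
    ∀ᵐ x ∂(volume.restrict (cube d ℓ)), ∀ᵐ t ∂(volume.restrict (Ioo 0 T)), p (t, x) := by
  rw [timeSpace, Measure.volume_eq_prod, ← Measure.prod_restrict] at hp
  have := Measure.measurePreserving_swap (μ := volume.restrict (cube d ℓ))
    (ν := volume.restrict (Ioo 0 T)) |>.quasiMeasurePreserving.ae hp
  exact Measure.ae_ae_of_ae_prod this

lemma ae_restrict_Ioc_of_Ioo {p : ℝ → Prop} (hp : ∀ᵐ t ∂(volume.restrict (Ioo 0 T)), p t)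
    {a b : ℝ} (ha : 0 ≤ a) (hb : b ≤ T) : ∀ᵐ t ∂(volume.restrict (Ioc a b)), p t := by
  rw [← Measure.restrict_congr_set Ioo_ae_eq_Ioc]
  exact ae_restrict_of_ae_restrict_of_subset (Ioo_subset_Ioo ha hb) hp

lemma integrable_prod_Ioc_cell {M : ℕ} {h : ℝ} (hh : 0 < h) (hM : M * h = ℓ)
    {F : ℝ × (Fin d → ℝ) → ℝ} (hF : IntegrableOn F (timeSpace d T ℓ)) {a b : ℝ} (ha : 0 ≤ a)
    (hb : b ≤ T) (j : Fin d → Fin M) :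
    Integrable F ((volume.restrict (Ioc a b)).prod (volume.restrict (cell h j))) := by
  rw [← Measure.restrict_congr_set Ioo_ae_eq_Ioc, Measure.prod_restrict, ← Measure.volume_eq_prod]
  exact hF.mono_set (Set.prod_mono (Ioo_subset_Ioo ha hb) (cell_subset_cube hh hM j))

lemma integrable_stepFun {M : ℕ} {h : ℝ} (v : (Fin d → Fin M) → ℝ) :
    IntegrableOn (stepFun h v) (cube d ℓ) := by
  refine Integrable.of_bound (measurable_stepFun h v).aestronglyMeasurable (∑ j, |v j|)
    (Eventually.of_forall fun x => ?_)
  refine (norm_sum_le _ _).trans (Finset.sum_le_sum fun j _ => ?_)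
  exact norm_indicator_le_norm_self (fun _ => v j) x

lemma integral_abs_stepFun {M : ℕ} {h : ℝ} (hh : 0 < h) (hM : M * h = ℓ)
    (v : (Fin d → Fin M) → ℝ) : ∫ x in cube d ℓ, |stepFun h v x| = ∑ j, h ^ d * |v j| := by
  rw [integral_cube_eq_sum hh hM (integrable_stepFun v).abs]
  refine Finset.sum_congr rfl fun j _ => ?_
  rw [setIntegral_congr_fun (measurableSet_cell h j) (g := fun _ => |v j|)
    fun x hx => by simp only [stepFun_of_mem_cell hh v hx], setIntegral_const,
    volume_real_cell hh.le, smul_eq_mul]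

lemma stepFun_sub {M : ℕ} (h : ℝ) (v w : (Fin d → Fin M) → ℝ) (x : Fin d → ℝ) :
    stepFun h (fun j => v j - w j) x = stepFun h v x - stepFun h w x := by
  simp only [stepFun, ← Finset.sum_sub_distrib]
  refine Finset.sum_congr rfl fun j _ => ?_
  by_cases hx : x ∈ cell h j <;> simp [hx]

lemma integrableOn_of_ae_mem_Icc {w : (Fin d → ℝ) → ℝ} {Cm CM : ℝ}
    (hw : AEStronglyMeasurable w (volume.restrict (cube d ℓ)))
    (hwr : ∀ᵐ y ∂(volume.restrict (cube d ℓ)), w y ∈ Icc Cm CM) : IntegrableOn w (cube d ℓ) :=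
  Integrable.of_bound hw (max |Cm| |CM|)
    (hwr.mono fun _ hy => abs_le_max_abs_abs hy.1 hy.2)

end Auxiliary

/-! ### Consistency of the nonlocal term -/

section Consistency

variable {d M KQ KR : ℕ}

/-- The integrands differ by `J (A - A')` plus `(J - r) A'`, where `A'` is the value at quantized
arguments. The first is controlled by the Lipschitz constant of `A` and the quantization of the data
at `y` and at `x`, the second by the quantization of the kernel. Mesh values stay in `[Cm, CM]`, so
`A` is only evaluated on `[-(CM - Cm), CM - Cm]`, however large `v` is. -/
lemma abs_nonlocalOp_sub_quantizedOp_le {ℓ h Cm CM JB AB δq δr : ℝ} {LA : ℝ≥0} (hℓ : 0 < ℓ)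
    {J : (Fin d → ℝ) → (Fin d → ℝ) → ℝ} {A : ℝ → ℝ} (hAc : Continuous A)
    (hAL : LipschitzOnWith LA A (Icc (-(CM - Cm)) (CM - Cm)))
    (hAB : ∀ s ∈ Icc (-(CM - Cm)) (CM - Cm), |A s| ≤ AB) (hJB : 0 ≤ JB)
    {q : Fin (KQ + 1) → ℝ} {r : Fin (KR + 1) → ℝ}
    {idxQ : ℝ → Fin (KQ + 1)} {idxR : ℝ → Fin (KR + 1)}
    (hQm : Measurable idxQ) (hRm : Measurable idxR) (hq : ∀ i, q i ∈ Icc Cm CM)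
    (hQ : ∀ w ∈ Icc Cm CM, ∀ ρ, |w - q (idxQ ρ)| ≤ 2 * |w - ρ| + δq)
    {w : (Fin d → ℝ) → ℝ} (hw : AEStronglyMeasurable w (volume.restrict (cube d ℓ)))
    (hwr : ∀ᵐ y ∂(volume.restrict (cube d ℓ)), w y ∈ Icc Cm CM) {x : Fin d → ℝ}
    (hwx : w x ∈ Icc Cm CM) (hJm : AEStronglyMeasurable (J x) (volume.restrict (cube d ℓ)))
    (hJb : ∀ᵐ y ∂(volume.restrict (cube d ℓ)), |J x y| ≤ JB)
    (hJr : ∀ᵐ y ∂(volume.restrict (cube d ℓ)), |J x y - r (idxR (J x y))| ≤ δr)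
    (v : (Fin d → Fin M) → ℝ) (s : ℝ) :
    |nonlocalOp ℓ J A w x - quantizedOp ℓ h J A q r idxQ idxR v (q (idxQ s)) x|
      ≤ JB * LA * (2 * (∫ y in cube d ℓ, |w y - stepFun h v y|)
          + (2 * |w x - s| + 2 * δq) * ℓ ^ d) + AB * δr * ℓ ^ d := by
  have hdiff : ∀ a ∈ Icc Cm CM, ∀ b ∈ Icc Cm CM, a - b ∈ Icc (-(CM - Cm)) (CM - Cm) :=
    fun a ha b hb => ⟨by linarith [ha.1, hb.2], by linarith [ha.2, hb.1]⟩
  have hi1 : Integrable (fun y => J x y * A (w y - w x)) (volume.restrict (cube d ℓ)) := by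
    refine Integrable.of_bound
      (hJm.mul (hAc.comp_aestronglyMeasurable (hw.sub aestronglyMeasurable_const))) (JB * AB) ?_
    filter_upwards [hwr, hJb] with y h1 h2
    rw [norm_mul]
    exact mul_le_mul h2 (hAB _ (hdiff _ h1 _ hwx)) (norm_nonneg _) hJB
  have hi2 : Integrable (fun y => r (idxR (J x y)) * A (q (idxQ (stepFun h v y)) - q (idxQ s)))
      (volume.restrict (cube d ℓ)) := by
    refine Integrable.of_bound (AEMeasurable.aestronglyMeasurable ?_) _
      (Eventually.of_forall fun y => abs_quantized_le A q r (q (idxQ s)) _ _)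
    exact (((measurable_of_finite r).comp hRm).comp_aemeasurable hJm.aemeasurable).mul
      (((measurable_of_finite fun i => A (q i - q (idxQ s))).comp
        (hQm.comp (measurable_stepFun h v))).aemeasurable)
  have hi3 : Integrable (fun y => |w y - stepFun h v y|) (volume.restrict (cube d ℓ)) :=
    ((integrableOn_of_ae_mem_Icc hw hwr).sub (integrable_stepFun v)).abs
  have hi4 : Integrable (fun y => JB * LA * (2 * |w y - stepFun h v y|)
      + (JB * LA * (2 * |w x - s| + 2 * δq) + AB * δr)) (volume.restrict (cube d ℓ)) :=
    ((hi3.const_mul 2).const_mul _).add (integrable_const _)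
  rw [nonlocalOp, quantizedOp, ← integral_sub hi1 hi2, ← Real.norm_eq_abs]
  calc _ ≤ ∫ y in cube d ℓ, (JB * LA * (2 * |w y - stepFun h v y|)
      + (JB * LA * (2 * |w x - s| + 2 * δq) + AB * δr)) := by
        refine norm_integral_le_of_norm_le hi4 ?_
        filter_upwards [hwr, hJb, hJr] with y h1 h2 h3
        have h4 := hAL.dist_le_mul _ (hdiff _ h1 _ hwx) _
          (hdiff _ (hq (idxQ (stepFun h v y))) _ (hq (idxQ s)))
        rw [Real.dist_eq, Real.dist_eq] at h4
        have h5 := hAB _ (hdiff _ (hq (idxQ (stepFun h v y))) _ (hq (idxQ s)))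
        have h6 : |w y - w x - (q (idxQ (stepFun h v y)) - q (idxQ s))|
            ≤ |w y - q (idxQ (stepFun h v y))| + |w x - q (idxQ s)| := by
          rw [show w y - w x - (q (idxQ (stepFun h v y)) - q (idxQ s))
            = (w y - q (idxQ (stepFun h v y))) - (w x - q (idxQ s)) by ring]
          exact abs_sub _ _
        have h7 : |A (w y - w x) - A (q (idxQ (stepFun h v y)) - q (idxQ s))|
            ≤ LA * (2 * |w y - stepFun h v y| + δq + (2 * |w x - s| + δq)) :=
          h4.trans (mul_le_mul_of_nonneg_left
            (h6.trans (add_le_add (hQ _ h1 _) (hQ _ hwx _))) LA.2)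
        have h8 : J x y * A (w y - w x)
            - r (idxR (J x y)) * A (q (idxQ (stepFun h v y)) - q (idxQ s))
            = J x y * (A (w y - w x) - A (q (idxQ (stepFun h v y)) - q (idxQ s)))
              + (J x y - r (idxR (J x y))) * A (q (idxQ (stepFun h v y)) - q (idxQ s)) := by
          ring
        rw [h8]
        refine (norm_add_le _ _).trans ?_
        rw [norm_mul, norm_mul, Real.norm_eq_abs, Real.norm_eq_abs, Real.norm_eq_abs,
          Real.norm_eq_abs]
        have h9 := mul_le_mul h2 h7 (abs_nonneg _) hJB
        have h10 := mul_le_mul h3 h5 (abs_nonneg _) ((abs_nonneg _).trans h3)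
        linarith
    _ = _ := by
        rw [integral_add ((hi3.const_mul 2).const_mul _) (integrable_const _),
          integral_const_mul, integral_const_mul, integral_const, measureReal_restrict_apply_univ,
          volume_real_cube hℓ.le, smul_eq_mul]
        ring

/-- Quantization truncates the data to `[Cm, CM]`, so the bound does not depend on `v`; this is what
makes the scheme stable. -/
lemma abs_quantizedOp_le {ℓ h Cm CM JB AB : ℝ} (hℓ : 0 < ℓ)
    {J : (Fin d → ℝ) → (Fin d → ℝ) → ℝ} {A : ℝ → ℝ}
    (hAB : ∀ s ∈ Icc (-(CM - Cm)) (CM - Cm), |A s| ≤ AB)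
    {q : Fin (KQ + 1) → ℝ} {r : Fin (KR + 1) → ℝ}
    (idxQ : ℝ → Fin (KQ + 1)) (idxR : ℝ → Fin (KR + 1)) (hq : ∀ i, q i ∈ Icc Cm CM)
    (hr : ∀ m, |r m| ≤ JB) (v : (Fin d → Fin M) → ℝ) (i : Fin (KQ + 1)) (x : Fin d → ℝ) :
    |quantizedOp ℓ h J A q r idxQ idxR v (q i) x| ≤ JB * AB * ℓ ^ d := by
  have := norm_integral_le_of_norm_le_const (μ := volume.restrict (cube d ℓ)) (C := JB * AB)
    (f := fun y => r (idxR (J x y)) * A (q (idxQ (stepFun h v y)) - q i))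
    (Eventually.of_forall fun y => by
      rw [norm_mul]
      exact mul_le_mul (hr _) (hAB _ ⟨by linarith [(hq i).2, (hq (idxQ (stepFun h v y))).1],
        by linarith [(hq i).1, (hq (idxQ (stepFun h v y))).2]⟩) (norm_nonneg _)
        ((abs_nonneg _).trans (hr 0)))
  rwa [measureReal_restrict_apply_univ, volume_real_cube hℓ.le] at this

end Consistency

/-! ### The averaged reaction term -/

section Reaction

variable {d M : ℕ} {T ℓ h τ : ℝ}

lemma abs_reactionMean_le (hh : 0 < h) (hM : M * h = ℓ) (hτ : 0 < τ) {n : ℕ}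
    (hn : (n + 1) * τ ≤ T) {f : ℝ → (Fin d → ℝ) → ℝ → ℝ} {s B : ℝ}
    (hf : ∀ᵐ p ∂(volume.restrict (timeSpace d T ℓ)), |f p.1 p.2 s| ≤ B) (j : Fin d → Fin M) :
    |reactionMean h τ f n j s| ≤ B := by
  have hab : (n : ℝ) * τ ≤ (n + 1) * τ := by linarith
  have h1 : ∀ᵐ t ∂(volume.restrict (Ioc (n * τ) ((n + 1) * τ))),
      ‖∫ x in cell h j, f t x s‖ ≤ B * h ^ d := by
    filter_upwards [ae_restrict_Ioc_of_Ioo (ae_ae_time_of_timeSpace hf)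
      (by positivity : 0 ≤ n * τ) hn] with t ht
    have := norm_integral_le_of_norm_le_const (C := B) (f := fun x => f t x s)
      (ae_restrict_cell_of_cube hh hM j ht)
    rwa [measureReal_restrict_apply_univ, volume_real_cell hh.le] at this
  have h2 := intervalIntegral.norm_integral_le_of_norm_le_const_ae (C := B * h ^ d)
    (f := fun t => ∫ x in cell h j, f t x s) (a := n * τ) (b := (n + 1) * τ) (by
      rw [uIoc_of_le hab]
      exact (ae_restrict_iff' measurableSet_Ioc).1 h1)
  rw [abs_of_nonneg (sub_nonneg.2 hab), show ((n : ℝ) + 1) * τ - n * τ = τ by ring,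
    Real.norm_eq_abs] at h2
  have hd : 0 < τ * h ^ d := by positivity
  rw [reactionMean, abs_mul, abs_of_pos (by positivity), one_div, inv_mul_le_iff₀ hd]
  linarith

/-- Fubini puts the time integral inside, so that the reaction can be compared with the equation
pointwise in `x` before averaging over the cell. -/
lemma integral_reaction (hh : 0 < h) (hM : M * h = ℓ) (hτ : 0 < τ) {n : ℕ}
    (hn : (n + 1) * τ ≤ T) {f : ℝ → (Fin d → ℝ) → ℝ → ℝ} {s : ℝ}
    (hf : IntegrableOn (fun p : ℝ × (Fin d → ℝ) => f p.1 p.2 s) (timeSpace d T ℓ))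
    (j : Fin d → Fin M) :
    IntegrableOn (fun x => ∫ t in (n * τ)..((n + 1) * τ), f t x s) (cell h j) ∧
    (∀ᵐ x ∂(volume.restrict (cell h j)),
      IntegrableOn (fun t => f t x s) (Ioc (n * τ) ((n + 1) * τ))) ∧
    τ * reactionMean h τ f n j s
      = cellMean h (fun x => ∫ t in (n * τ)..((n + 1) * τ), f t x s) j := by
  have hab : (n : ℝ) * τ ≤ (n + 1) * τ := by linarith
  have hi := integrable_prod_Ioc_cell hh hM hf (by positivity : 0 ≤ n * τ) hn j
  simp_rw [intervalIntegral.integral_of_le hab]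
  refine ⟨hi.integral_prod_right, hi.prod_left_ae, ?_⟩
  rw [reactionMean, cellMean, intervalIntegral.integral_of_le hab,
    integral_integral_swap (f := fun t x => f t x s) hi]
  field_simp

end Reaction

/-! ### Uniform bounds on the solution -/

section Solution

variable {d : ℕ} {T ℓ : ℝ} {J : (Fin d → ℝ) → (Fin d → ℝ) → ℝ} {A : ℝ → ℝ}
  {f : ℝ → (Fin d → ℝ) → ℝ → ℝ} {u₀ : (Fin d → ℝ) → ℝ} {u : ℝ → (Fin d → ℝ) → ℝ}

/-- By subadditivity and continuity in time, the variation near `t₀` is at most one more than at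
`t₀`; compactness of `[0, T]` makes the bound uniform. -/
lemma IsSolution.exists_variation_le (hu : IsSolution T ℓ J A f u₀ u) :
    ∃ V : ℝ, 0 ≤ V ∧
      ∀ t ∈ Icc 0 T, (variation (dirs d) (cube d ℓ) (u t)).toReal ≤ V := by
  have key : ∃ V : ℝ≥0∞, V < ∞ ∧ ∀ t ∈ Icc 0 T, variation (dirs d) (cube d ℓ) (u t) ≤ V := by
    refine isCompact_Icc.induction_on
      (p := fun S => ∃ V : ℝ≥0∞, V < ∞ ∧ ∀ t ∈ S, variation (dirs d) (cube d ℓ) (u t) ≤ V)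
      ⟨0, ENNReal.zero_lt_top, by simp⟩ ?_ ?_ ?_
    · rintro S S' hS ⟨V, hV, h⟩
      exact ⟨V, hV, fun t ht => h t (hS ht)⟩
    · rintro S S' ⟨V, hV, h⟩ ⟨V', hV', h'⟩
      refine ⟨max V V', max_lt hV hV', fun t ht => ?_⟩
      rcases ht with ht | ht
      · exact (h t ht).trans (le_max_left _ _)
      · exact (h' t ht).trans (le_max_right _ _)
    · intro t₀ ht₀
      have h1 := (hu.continuous t₀ ht₀).eventually (gt_mem_nhds zero_lt_one)
      refine ⟨_, h1.and self_mem_nhdsWithin, 1 + variation (dirs d) (cube d ℓ) (u t₀),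
        ENNReal.add_lt_top.2 ⟨ENNReal.one_lt_top, (hu.memBV t₀ ht₀).2⟩, ?_⟩
      rintro t ⟨h2, ht⟩
      have hi : IntegrableOn (u t) (cube d ℓ) := memLp_one_iff_integrable.1 (hu.memBV t ht).1
      have hi₀ : IntegrableOn (u t₀) (cube d ℓ) := memLp_one_iff_integrable.1 (hu.memBV t₀ ht₀).1
      have h3 := variation_add_le (e := dirs d) (hi.sub hi₀) hi₀
      simp only [Pi.sub_apply, sub_add_cancel] at h3
      refine h3.trans (add_le_add ?_ le_rfl)
      exact le_add_self.trans h2.le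
  obtain ⟨V, hV, h⟩ := key
  exact ⟨V.toReal, ENNReal.toReal_nonneg, fun t ht => ENNReal.toReal_mono hV.ne (h t ht)⟩

/-- For a.e. `x`, the trajectory and its truncation to `[Cm, CM]` are continuous in time and agree
a.e., hence at every time. -/
lemma IsSolution.ae_forall_mem_Icc (hT : 0 < T) (hu : IsSolution T ℓ J A f u₀ u) {Cm CM : ℝ}
    (hrange : ∀ᵐ p ∂(volume.restrict (timeSpace d T ℓ)), u p.1 p.2 ∈ Icc Cm CM) :
    ∀ᵐ x ∂(volume.restrict (cube d ℓ)), ∀ t ∈ Icc 0 T, u t x ∈ Icc Cm CM := by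
  obtain ⟨K, hK⟩ := hu.lipschitz
  filter_upwards [hK, ae_ae_space_of_timeSpace hrange] with x h1 h2 t ht
  have hc := h1.continuousOn
  have h3 : (fun t => u t x) =ᵐ[volume.restrict (Icc 0 T)] fun t => max Cm (min CM (u t x)) := by
    rw [← Measure.restrict_congr_set Ioo_ae_eq_Icc]
    filter_upwards [h2] with s hs
    rw [min_eq_right hs.2, max_eq_right hs.1]
  have h4 := Measure.eqOn_Icc_of_ae_eq volume hT.ne h3 hc
    ((continuous_const.max (continuous_const.min continuous_id)).comp_continuousOn hc) ht
  -- One time with value in the interval yields `Cm ≤ CM`, without which the truncation need not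
  -- land there.
  obtain ⟨s, hs⟩ : ∃ s, u s x ∈ Icc Cm CM := by
    have : (ae (volume.restrict (Ioo 0 T))).NeBot := by
      rw [ae_neBot, Ne, Measure.restrict_eq_zero, Real.volume_Ioo, sub_zero,
        ENNReal.ofReal_eq_zero]
      exact not_le.2 hT
    exact h2.exists
  simp only at h4
  rw [h4]
  exact ⟨le_max_left _ _, max_le (hs.1.trans hs.2) (min_le_left _ _)⟩

end Solution

/-! ### Propagation of the error over one time step -/

section ErrorStep

variable {d M KQ KR : ℕ}

/-- The error of cell means at the new time is the old one plus the cell mean of a defect `D j`,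
which is bounded pointwise by integrating the equation along a.e. trajectory. The bound `R` covers
both `u` and `v`, so that `f` is Lipschitz between them. -/
lemma sum_abs_error_step_le {T ℓ h τ Cm CM JB AB δq δr R : ℝ} {K LA Kf : ℝ≥0} (hℓ : 0 < ℓ)
    (hh : 0 < h) (hM : M * h = ℓ) (hτ : 0 < τ) {n : ℕ} (hn : (n + 1) * τ ≤ T)
    {J : (Fin d → ℝ) → (Fin d → ℝ) → ℝ} {A : ℝ → ℝ} {f : ℝ → (Fin d → ℝ) → ℝ → ℝ}
    {u : ℝ → (Fin d → ℝ) → ℝ}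
    (hAc : Continuous A)
    (hAL : LipschitzOnWith LA A (Icc (-(CM - Cm)) (CM - Cm)))
    (hAB : ∀ s ∈ Icc (-(CM - Cm)) (CM - Cm), |A s| ≤ AB) (hJB : 0 ≤ JB)
    {q : Fin (KQ + 1) → ℝ} {r : Fin (KR + 1) → ℝ}
    {idxQ : ℝ → Fin (KQ + 1)} {idxR : ℝ → Fin (KR + 1)}
    (hQm : Measurable idxQ) (hRm : Measurable idxR) (hq : ∀ i, q i ∈ Icc Cm CM)
    (hQ : ∀ w ∈ Icc Cm CM, ∀ ρ, |w - q (idxQ ρ)| ≤ 2 * |w - ρ| + δq)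
    (hum : ∀ t ∈ Icc 0 T, AEStronglyMeasurable (u t) (volume.restrict (cube d ℓ)))
    (hur : ∀ᵐ x ∂(volume.restrict (cube d ℓ)), ∀ t ∈ Icc 0 T, u t x ∈ Icc Cm CM)
    (hul : ∀ᵐ x ∂(volume.restrict (cube d ℓ)), LipschitzOnWith K (fun t => u t x) (Icc 0 T))
    (hue : ∀ᵐ x ∂(volume.restrict (cube d ℓ)), ∀ᵐ t ∂(volume.restrict (Ioo 0 T)),
      HasDerivAt (fun s => u s x) (nonlocalOp ℓ J A (u t) x + f t x (u t x)) t)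
    (hJm : AEStronglyMeasurable (fun z : (Fin d → ℝ) × (Fin d → ℝ) => J z.1 z.2)
      (volume.restrict (cube d ℓ ×ˢ cube d ℓ)))
    (hJb : ∀ᵐ z ∂(volume.restrict (cube d ℓ ×ˢ cube d ℓ)), |J z.1 z.2| ≤ JB)
    (hJr : ∀ᵐ z ∂(volume.restrict (cube d ℓ ×ˢ cube d ℓ)),
      |J z.1 z.2 - r (idxR (J z.1 z.2))| ≤ δr)
    (hfi : ∀ s, IntegrableOn (fun p : ℝ × (Fin d → ℝ) => f p.1 p.2 s) (timeSpace d T ℓ))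
    (hfl : ∀ᵐ p ∂(volume.restrict (timeSpace d T ℓ)),
      LipschitzOnWith Kf (f p.1 p.2) (Icc (-R) R))
    (hR : Icc Cm CM ⊆ Icc (-R) R) (v : (Fin d → Fin M) → ℝ) (hv : ∀ j, |v j| ≤ R) :
    ∑ j : Fin d → Fin M, h ^ d * |cellMean h (u ((n + 1) * τ)) j
        - (v j + τ * (discreteOp h J A q r idxQ idxR v j + reactionMean h τ f n j (v j)))|
      ≤ ∑ j : Fin d → Fin M, h ^ d * |cellMean h (u (n * τ)) j - v j|
        + τ * ((4 * JB * LA * ℓ ^ d + Kf) * (∫ x in cube d ℓ, |u (n * τ) x - stepFun h v x|)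
          + (4 * JB * LA * K * (ℓ ^ d) ^ 2 + Kf * K * ℓ ^ d) * τ
          + 2 * JB * LA * (ℓ ^ d) ^ 2 * δq + AB * (ℓ ^ d) ^ 2 * δr) := by
  set t₀ := (n : ℝ) * τ with ht₀
  set t₁ := ((n : ℝ) + 1) * τ with ht₁
  have ht₀₁ : t₁ - t₀ = τ := by rw [ht₀, ht₁]; ring
  have h0t : 0 ≤ t₀ := by positivity
  have hle : t₀ ≤ t₁ := by linarith
  have hmem₀ : t₀ ∈ Icc 0 T := ⟨h0t, hle.trans hn⟩
  have hmem₁ : t₁ ∈ Icc 0 T := ⟨h0t.trans hle, hn⟩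
  have hΛ : 0 < ℓ ^ d := by positivity
  have hd : 0 < h ^ d := by positivity
  have hur' : ∀ t ∈ Icc 0 T, ∀ᵐ x ∂(volume.restrict (cube d ℓ)), u t x ∈ Icc Cm CM :=
    fun t ht => hur.mono fun x hx => hx t ht
  have hui : ∀ t ∈ Icc 0 T, IntegrableOn (u t) (cube d ℓ) := fun t ht =>
    integrableOn_of_ae_mem_Icc (hum t ht) (hur' t ht)
  have hai : ∀ t ∈ Icc 0 T, IntegrableOn (fun x => |u t x - stepFun h v x|) (cube d ℓ) :=
    fun t ht => ((hui t ht).sub (integrable_stepFun v)).abs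
  set m := ∫ x in cube d ℓ, |u t₀ x - stepFun h v x| with hm
  have htime : ∀ t ∈ Ioc t₀ t₁, t ∈ Icc 0 T ∧ |t - t₀| ≤ τ := fun t ht =>
    ⟨⟨h0t.trans ht.1.le, ht.2.trans hn⟩, by
      rw [abs_of_nonneg (by linarith [ht.1])]; linarith [ht.2]⟩
  have hulip : ∀ᵐ x ∂(volume.restrict (cube d ℓ)), ∀ t ∈ Ioc t₀ t₁,
      ∀ c, |u t x - c| ≤ |u t₀ x - c| + K * τ := by
    filter_upwards [hul] with x hx t ht c
    have h1 := hx.dist_le_mul t (htime t ht).1 t₀ hmem₀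
    rw [Real.dist_eq, Real.dist_eq] at h1
    have h2 := mul_le_mul_of_nonneg_left (htime t ht).2 K.coe_nonneg
    have h3 := abs_sub_le (u t x) (u t₀ x) c
    linarith
  have hmt : ∀ t ∈ Ioc t₀ t₁,
      ∫ x in cube d ℓ, |u t x - stepFun h v x| ≤ m + K * τ * ℓ ^ d := by
    intro t ht
    calc ∫ x in cube d ℓ, |u t x - stepFun h v x|
        ≤ ∫ x in cube d ℓ, (|u t₀ x - stepFun h v x| + K * τ) :=
          integral_mono_ae (hai t (htime t ht).1) ((hai t₀ hmem₀).add (integrable_const _))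
            (hulip.mono fun x hx => hx t ht _)
      _ = _ := by
          rw [integral_add (hai t₀ hmem₀) (integrable_const _), integral_const,
            measureReal_restrict_apply_univ, volume_real_cube hℓ.le, smul_eq_mul]
          ring
  -- `α` multiplies the error at the point itself; `β` collects what is uniform in `x`: the L¹ error
  -- `m` entering through the nonlocal integral, the time lag `K τ` and the quantization.
  -- Integrating `α |u - v| + β` adds a second `2 * JB * LA * ℓ ^ d` in front of `m`, whence the 4
  -- in the statement.
  set α : ℝ := 2 * JB * LA * ℓ ^ d + Kf with hα
  set β : ℝ := JB * LA * (2 * (m + K * τ * ℓ ^ d) + (2 * (K * τ) + 2 * δq) * ℓ ^ d)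
    + AB * δr * ℓ ^ d + Kf * (K * τ) with hβ
  let G : (Fin d → Fin M) → (Fin d → ℝ) → ℝ := fun j =>
    quantizedOp ℓ h J A q r idxQ idxR v (q (idxQ (v j)))
  let D : (Fin d → Fin M) → (Fin d → ℝ) → ℝ := fun j x =>
    u t₁ x - u t₀ x - τ * G j x - ∫ t in t₀..t₁, f t x (v j)
  have hJmx : ∀ᵐ x ∂(volume.restrict (cube d ℓ)),
      AEStronglyMeasurable (J x) (volume.restrict (cube d ℓ)) := by
    obtain ⟨J', hJ', hJJ'⟩ := exists_measurable_kernel hJm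
    filter_upwards [hJJ'] with x hx
    exact (hJ'.comp measurable_prodMk_left).aestronglyMeasurable.congr (hx.mono fun y hy => hy.symm)
  have hDb : ∀ j, ∀ᵐ x ∂(volume.restrict (cell h j)),
      |D j x| ≤ τ * (α * |u t₀ x - stepFun h v x| + β) := by
    intro j
    filter_upwards [ae_restrict_cell_of_cube hh hM j hur, ae_restrict_cell_of_cube hh hM j hul,
      ae_restrict_cell_of_cube hh hM j hulip, ae_restrict_cell_of_cube hh hM j hue,
      ae_restrict_cell_of_cube hh hM j hJmx,
      ae_restrict_cell_of_cube hh hM j (ae_ae_cube_of_ae_prod hJb),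
      ae_restrict_cell_of_cube hh hM j (ae_ae_cube_of_ae_prod hJr),
      ae_restrict_cell_of_cube hh hM j (ae_ae_space_of_timeSpace hfl),
      (integral_reaction hh hM hτ hn (hfi (v j)) j).2.1,
      ae_restrict_mem (measurableSet_cell h j)] with x x1 x2 x3 x4 x5 x6 x7 x8 x9 x10
    rw [stepFun_of_mem_cell hh v x10]
    have hstep := abs_sub_sub_integral_le_of_ae_hasDerivAt (φ := fun t => u t x)
      (F := fun t => nonlocalOp ℓ J A (u t) x + f t x (u t x))
      (g := fun t => G j x + f t x (v j)) (B := α * |u t₀ x - v j| + β) hle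
      (x2.mono (Icc_subset_Icc h0t hn)) (ae_restrict_Ioc_of_Ioo x4 h0t hn)
      ((integrable_const _).add x9) (by
        filter_upwards [ae_restrict_Ioc_of_Ioo x8 h0t hn, ae_restrict_mem measurableSet_Ioc]
          with t hft ht
        have htT := (htime t ht).1
        have b1 := abs_nonlocalOp_sub_quantizedOp_le (h := h) hℓ hAc hAL hAB hJB hQm hRm hq hQ
          (hum t htT) (hur' t htT) (x1 t htT) x5 x6 x7 v (v j)
        have b2 := hft.dist_le_mul _ (hR (x1 t htT)) _ (abs_le.1 (hv j))
        rw [Real.dist_eq, Real.dist_eq] at b2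
        have b3 := x3 t ht (v j)
        have b4 := hmt t ht
        have b5 : |nonlocalOp ℓ J A (u t) x + f t x (u t x) - (G j x + f t x (v j))|
            ≤ |nonlocalOp ℓ J A (u t) x - G j x| + |f t x (u t x) - f t x (v j)| := by
          rw [add_sub_add_comm]
          exact abs_add_le _ _
        have b6 : JB * LA * (2 * (∫ y in cube d ℓ, |u t y - stepFun h v y|)
            + (2 * |u t x - v j| + 2 * δq) * ℓ ^ d)
            ≤ JB * LA * (2 * (m + K * τ * ℓ ^ d)
              + (2 * (|u t₀ x - v j| + K * τ) + 2 * δq) * ℓ ^ d) := by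
          gcongr
        have b7 : Kf * |u t x - v j| ≤ Kf * (|u t₀ x - v j| + K * τ) := by gcongr
        refine b5.trans ((add_le_add b1 b2).trans ?_)
        rw [hα, hβ]
        linarith)
    have hsplit : ∫ t in t₀..t₁, (G j x + f t x (v j))
        = τ * G j x + ∫ t in t₀..t₁, f t x (v j) := by
      rw [intervalIntegral.integral_add intervalIntegrable_const
        ((intervalIntegrable_iff_integrableOn_Ioc_of_le hle).2 x9),
        intervalIntegral.integral_const, ht₀₁, smul_eq_mul]
    rw [hsplit, ht₀₁] at hstep
    simp only [D]
    rw [sub_sub, mul_comm τ (_ + _)]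
    exact hstep
  have hDi : ∀ j, IntegrableOn (D j) (cell h j) ∧ cellMean h (D j) j
      = cellMean h (u t₁) j - cellMean h (u t₀) j
        - τ * (discreteOp h J A q r idxQ idxR v j + reactionMean h τ f n j (v j)) := by
    intro j
    have hsub := cell_subset_cube hh hM j
    have i1 := (hui t₁ hmem₁).mono_set hsub
    have i2 := (hui t₀ hmem₀).mono_set hsub
    have i3 : IntegrableOn (fun x => τ * G j x) (cell h j) :=
      ((integrableOn_quantizedOp hJm A q r hQm hRm v (q (idxQ (v j)))).mono_set hsub).const_mul τ
    obtain ⟨i4', -, h4'⟩ := integral_reaction hh hM hτ hn (hfi (v j)) j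
    have i4 : IntegrableOn (fun x => ∫ t in t₀..t₁, f t x (v j)) (cell h j) := i4'
    have h4 : τ * reactionMean h τ f n j (v j)
      = cellMean h (fun x => ∫ t in t₀..t₁, f t x (v j)) j := h4'
    have i5 : IntegrableOn (fun x => u t₁ x - u t₀ x) (cell h j) := i1.sub i2
    have i6 : IntegrableOn (fun x => u t₁ x - u t₀ x - τ * G j x) (cell h j) := i5.sub i3
    refine ⟨i6.sub i4, ?_⟩
    rw [mul_add, h4, discreteOp_eq_cellMean_quantizedOp hh hM hJm A q r hQm hRm v j]
    simp only [cellMean, D]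
    rw [integral_sub i6 i4, integral_sub i5 i3, integral_sub i1 i2, integral_const_mul]
    ring
  have hcell : ∀ j : Fin d → Fin M, h ^ d * |cellMean h (u t₁) j
        - (v j + τ * (discreteOp h J A q r idxQ idxR v j + reactionMean h τ f n j (v j)))|
      ≤ h ^ d * |cellMean h (u t₀) j - v j|
        + ∫ x in cell h j, τ * (α * |u t₀ x - stepFun h v x| + β) := by
    intro j
    have e1 : cellMean h (u t₁) j
        - (v j + τ * (discreteOp h J A q r idxQ idxR v j + reactionMean h τ f n j (v j)))
        = (cellMean h (u t₀) j - v j) + cellMean h (D j) j := by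
      rw [(hDi j).2]; ring
    have e2 : h ^ d * |cellMean h (D j) j|
        ≤ ∫ x in cell h j, τ * (α * |u t₀ x - stepFun h v x| + β) := by
      rw [cellMean, abs_mul, abs_of_pos (by positivity : 0 < 1 / h ^ d), ← mul_assoc,
        mul_one_div_cancel hd.ne', one_mul, ← Real.norm_eq_abs]
      refine norm_integral_le_of_norm_le ?_ (hDb j)
      exact ((((hai t₀ hmem₀).mono_set (cell_subset_cube hh hM j)).const_mul α).add
        (integrable_const β)).const_mul τ
    rw [e1]
    have e3 := mul_le_mul_of_nonneg_left
      (abs_add_le (cellMean h (u t₀) j - v j) (cellMean h (D j) j)) hd.le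
    linarith
  refine (Finset.sum_le_sum fun j _ => hcell j).trans ?_
  have hBi : IntegrableOn (fun x => τ * (α * |u t₀ x - stepFun h v x| + β)) (cube d ℓ) :=
    (((hai t₀ hmem₀).const_mul α).add (integrable_const β)).const_mul τ
  rw [Finset.sum_add_distrib, ← integral_cube_eq_sum hh hM hBi,
    integral_const_mul, integral_add ((hai t₀ hmem₀).const_mul α) (integrable_const β),
    integral_const_mul, integral_const, measureReal_restrict_apply_univ, volume_real_cube hℓ.le,
    smul_eq_mul, ← hm, hα, hβ]
  refine le_of_eq ?_
  ring

end ErrorStep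

/-! ### Stability of the scheme and L¹ bounds -/

section Bounds

variable {d M : ℕ}

lemma restrict_cube_neBot {ℓ : ℝ} (hℓ : 0 < ℓ) : (ae (volume.restrict (cube d ℓ))).NeBot := by
  rw [ae_neBot, Ne, Measure.restrict_eq_zero, volume_cube]
  exact (ENNReal.pow_pos (ENNReal.ofReal_pos.2 hℓ) d).ne'

lemma ae_kernel_mem_Icc {ℓ : ℝ} {J : (Fin d → ℝ) → (Fin d → ℝ) → ℝ}
    (hJb : MemLp (fun z : (Fin d → ℝ) × (Fin d → ℝ) => J z.1 z.2) ∞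
      (volume.restrict (cube d ℓ ×ˢ cube d ℓ))) :
    ∀ᵐ z ∂(volume.restrict (cube d ℓ ×ˢ cube d ℓ)),
      J z.1 z.2 ∈ Icc (kernelInf ℓ J) (kernelSup ℓ J) := by
  obtain ⟨B, hB⟩ : ∃ B : ℝ, ∀ᵐ z ∂(volume.restrict (cube d ℓ ×ˢ cube d ℓ)), |J z.1 z.2| ≤ B :=
    ⟨_, ae_le_lpNorm_exponent_top hJb⟩
  have h1 : IsBoundedUnder (· ≤ ·) (ae (volume.restrict (cube d ℓ ×ˢ cube d ℓ)))
      fun z : (Fin d → ℝ) × (Fin d → ℝ) => J z.1 z.2 :=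
    ⟨B, eventually_map.2 (hB.mono fun z hz => (abs_le.1 hz).2)⟩
  have h2 : IsBoundedUnder (· ≥ ·) (ae (volume.restrict (cube d ℓ ×ˢ cube d ℓ)))
      fun z : (Fin d → ℝ) × (Fin d → ℝ) => J z.1 z.2 :=
    ⟨-B, eventually_map.2 (hB.mono fun z hz => (abs_le.1 hz).1)⟩
  filter_upwards [ae_le_essSup h1, ae_essInf_le h2] with z hz1 hz2 using ⟨hz2, hz1⟩

lemma kernelInf_le_kernelSup {ℓ : ℝ} (hℓ : 0 < ℓ) {J : (Fin d → ℝ) → (Fin d → ℝ) → ℝ}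
    (hJb : MemLp (fun z : (Fin d → ℝ) × (Fin d → ℝ) => J z.1 z.2) ∞
      (volume.restrict (cube d ℓ ×ˢ cube d ℓ))) : kernelInf ℓ J ≤ kernelSup ℓ J := by
  have := restrict_cube_neBot (d := d) hℓ
  obtain ⟨x, hx⟩ := (ae_ae_cube_of_ae_prod (ae_kernel_mem_Icc hJb)).exists
  obtain ⟨y, hy⟩ := hx.exists
  exact hy.1.trans hy.2

/-- Triangle inequality through the cell means of `g`: the Poincaré inequality bounds the first
part, and the second is the discrete error. -/
lemma integral_abs_sub_stepFun_le {ℓ h : ℝ} (hh : 0 < h) (hM : M * h = ℓ)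
    {g : (Fin d → ℝ) → ℝ} (hg : MemBV (dirs d) (cube d ℓ) g) {V : ℝ}
    (hV : (variation (dirs d) (cube d ℓ) g).toReal ≤ V) (v : (Fin d → Fin M) → ℝ) :
    ∫ x in cube d ℓ, |g x - stepFun h v x|
      ≤ 2 ^ d * d * V * h + ∑ j, h ^ d * |cellMean h g j - v j| := by
  have hgi : IntegrableOn g (cube d ℓ) := memLp_one_iff_integrable.1 hg.1
  have h1 := integral_abs_sub_stepFun_cellMean_le hh hM hg
  have h2 := integral_abs_stepFun hh hM fun j => cellMean h g j - v j
  simp_rw [stepFun_sub] at h2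
  have i1 : IntegrableOn (fun x => |g x - stepFun h (cellMean (M := M) h g) x|) (cube d ℓ) :=
    (hgi.sub (integrable_stepFun _)).abs
  have i2 : IntegrableOn (fun x => |stepFun h (cellMean (M := M) h g) x - stepFun h v x|)
      (cube d ℓ) := ((integrable_stepFun _).sub (integrable_stepFun _)).abs
  have h3 : (2 : ℝ) ^ d * d * h * (variation (dirs d) (cube d ℓ) g).toReal
      ≤ 2 ^ d * d * V * h := by
    rw [mul_right_comm ((2 : ℝ) ^ d * d) V h]
    gcongr
  calc ∫ x in cube d ℓ, |g x - stepFun h v x|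
      ≤ ∫ x in cube d ℓ, (|g x - stepFun h (cellMean (M := M) h g) x|
        + |stepFun h (cellMean (M := M) h g) x - stepFun h v x|) :=
        integral_mono (hgi.sub (integrable_stepFun v)).abs (i1.add i2)
          fun x => abs_sub_le _ _ _
    _ ≤ _ := by
        rw [integral_add i1 i2, h2]
        linarith

lemma eLpNorm_sub_stepFun_le_of_lipschitz {T ℓ h : ℝ} {K : ℝ≥0} (hℓ : 0 < ℓ)
    {u : ℝ → (Fin d → ℝ) → ℝ} (hui : ∀ t ∈ Icc 0 T, IntegrableOn (u t) (cube d ℓ))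
    (hul : ∀ᵐ x ∂(volume.restrict (cube d ℓ)), LipschitzOnWith K (fun t => u t x) (Icc 0 T))
    {t s : ℝ} (ht : t ∈ Icc 0 T) (hs : s ∈ Icc 0 T) (v : (Fin d → Fin M) → ℝ) :
    eLpNorm (fun x => u t x - stepFun h v x) 1 (volume.restrict (cube d ℓ))
      ≤ ENNReal.ofReal ((∫ x in cube d ℓ, |u s x - stepFun h v x|) + K * |t - s| * ℓ ^ d) := by
  have i1 : IntegrableOn (fun x => u t x - stepFun h v x) (cube d ℓ) :=
    (hui t ht).sub (integrable_stepFun _)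
  have i2 : IntegrableOn (fun x => |u s x - stepFun h v x|) (cube d ℓ) :=
    ((hui s hs).sub (integrable_stepFun _)).abs
  rw [eLpNorm_one_eq_lintegral_enorm, ← ofReal_integral_norm_eq_lintegral_enorm i1]
  refine ENNReal.ofReal_le_ofReal ?_
  calc ∫ x in cube d ℓ, ‖u t x - stepFun h v x‖
      ≤ ∫ x in cube d ℓ, (|u s x - stepFun h v x| + K * |t - s|) := by
        refine integral_mono_ae i1.norm (i2.add (integrable_const _)) ?_
        filter_upwards [hul] with x hx
        have h1 := hx.dist_le_mul t ht s hs
        rw [Real.dist_eq, Real.dist_eq] at h1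
        have h3 := abs_sub_le (u t x) (u s x) (stepFun h v x)
        rw [Real.norm_eq_abs]
        linarith
    _ = _ := by
        rw [integral_add i2 (integrable_const _), integral_const,
          measureReal_restrict_apply_univ, volume_real_cube hℓ.le, smul_eq_mul]
        ring

/-- The nonlocal term is bounded independently of the iterate, so only the linear growth of the
reaction feeds Grönwall, and the bound is free of the mesh parameters. -/
lemma abs_scheme_le {T ℓ h τ Cm CM JB AB Cf : ℝ} {KQ KR N : ℕ} (hℓ : 0 < ℓ) (hh : 0 < h)
    (hM : M * h = ℓ) (hτ : 0 < τ) (hN : N * τ = T)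
    {J : (Fin d → ℝ) → (Fin d → ℝ) → ℝ} {A : ℝ → ℝ} {f : ℝ → (Fin d → ℝ) → ℝ → ℝ}
    {u₀ : (Fin d → ℝ) → ℝ}
    (hJm : AEStronglyMeasurable (fun z : (Fin d → ℝ) × (Fin d → ℝ) => J z.1 z.2)
      (volume.restrict (cube d ℓ ×ˢ cube d ℓ)))
    (hAB : ∀ s ∈ Icc (-(CM - Cm)) (CM - Cm), |A s| ≤ AB) (hAB0 : 0 ≤ AB) (hJB : 0 ≤ JB)
    {q : Fin (KQ + 1) → ℝ} {r : Fin (KR + 1) → ℝ}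
    {idxQ : ℝ → Fin (KQ + 1)} {idxR : ℝ → Fin (KR + 1)}
    (hQm : Measurable idxQ) (hRm : Measurable idxR) (hq : ∀ i, q i ∈ Icc Cm CM)
    (hr : ∀ m, |r m| ≤ JB) (hCf : 0 < Cf)
    (hf : ∀ s, ∀ᵐ p ∂(volume.restrict (timeSpace d T ℓ)), |f p.1 p.2 s| ≤ Cf * (1 + |s|))
    (hu₀i : IntegrableOn u₀ (cube d ℓ))
    (hu₀ : ∀ᵐ x ∂(volume.restrict (cube d ℓ)), u₀ x ∈ Icc Cm CM)
    {n : ℕ} (hn : n ≤ N) (j : Fin d → Fin M) :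
    |scheme h τ J A f u₀ q r idxQ idxR n j|
      ≤ (max |Cm| |CM| + T * (JB * AB * ℓ ^ d + Cf)) * Real.exp (Cf * T) := by
  have hb : 0 ≤ JB * AB * ℓ ^ d + Cf := by positivity
  have hg := discrete_gronwall_le (e := fun n => |scheme h τ J A f u₀ q r idxQ idxR n j|)
    (a := max |Cm| |CM|) (b := JB * AB * ℓ ^ d + Cf) (c := Cf) (N := N) hτ.le hb hCf.le
    ((abs_nonneg _).trans (le_max_left _ _)) (by
      have := abs_cellMean_sub_le hh j (hu₀i.mono_set (cell_subset_cube hh hM j)) 0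
        (max |Cm| |CM|) (by
          filter_upwards [ae_restrict_cell_of_cube hh hM j hu₀] with x hx
          rw [sub_zero]
          exact abs_le_max_abs_abs hx.1 hx.2)
      rwa [sub_zero] at this) (by
      intro k hk
      have hk' : ((k : ℝ) + 1) * τ ≤ T := by
        rw [← hN]
        refine mul_le_mul_of_nonneg_right ?_ hτ.le
        exact_mod_cast hk
      set v := scheme h τ J A f u₀ q r idxQ idxR k with hv
      have h1 : |discreteOp h J A q r idxQ idxR v j| ≤ JB * AB * ℓ ^ d := by
        rw [discreteOp_eq_cellMean_quantizedOp hh hM hJm A q r hQm hRm v j]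
        have := abs_cellMean_sub_le hh j ((integrableOn_quantizedOp (h := h) hJm A q r hQm hRm v
          (q (idxQ (v j)))).mono_set (cell_subset_cube hh hM j)) 0 (JB * AB * ℓ ^ d)
          (Eventually.of_forall fun x => by
            rw [sub_zero]
            exact abs_quantizedOp_le hℓ hAB idxQ idxR hq hr v _ x)
        rwa [sub_zero] at this
      have h2 := abs_reactionMean_le hh hM hτ hk' (hf (v j)) j
      have h3 : scheme h τ J A f u₀ q r idxQ idxR (k + 1) j
        = v j + τ * (discreteOp h J A q r idxQ idxR v j + reactionMean h τ f k j (v j)) := rfl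
      rw [h3]
      have h4 := abs_add_le (v j)
        (τ * (discreteOp h J A q r idxQ idxR v j + reactionMean h τ f k j (v j)))
      rw [abs_mul, abs_of_pos hτ] at h4
      have h5 := mul_le_mul_of_nonneg_left ((abs_add_le (discreteOp h J A q r idxQ idxR v j)
        (reactionMean h τ f k j (v j))).trans (add_le_add h1 h2)) hτ.le
      linarith) hn
  have hnT : (n : ℝ) * τ ≤ T := by
    rw [← hN]
    exact mul_le_mul_of_nonneg_right (by exact_mod_cast hn) hτ.le
  have hT : 0 ≤ T := le_trans (by positivity) hnT
  refine hg.trans ?_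
  have : (0 : ℝ) ≤ max |Cm| |CM| := (abs_nonneg _).trans (le_max_left _ _)
  gcongr

end Bounds

end NonlocalDiffusion

/-! ### The error estimate -/

set_option maxHeartbeats 400000 in
theorem mainTheorem2 (d : ℕ) (hd : 1 ≤ d) (T ℓ : ℝ) (hT : 0 < T) (hℓ : 0 < ℓ)
    (J : (Fin d → ℝ) → (Fin d → ℝ) → ℝ) (A : ℝ → ℝ)
    (f : ℝ → (Fin d → ℝ) → ℝ → ℝ) (u₀ : (Fin d → ℝ) → ℝ)
    (hJ : IsSpatialKernel d ℓ J)
    (hJb : MemLp (fun z : (Fin d → ℝ) × (Fin d → ℝ) => J z.1 z.2) ∞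
      (volume.restrict (cube d ℓ ×ˢ cube d ℓ)))
    (hA : IsRangeKernel A) (hf : IsReaction d T ℓ f) (hu₀ : IsInitialDatum d ℓ u₀)
    (u : ℝ → (Fin d → ℝ) → ℝ) (hu : IsSolution T ℓ J A f u₀ u)
    (Cm CM : ℝ)
    (hrange : ∀ᵐ p ∂(volume.restrict (timeSpace d T ℓ)), u p.1 p.2 ∈ Icc Cm CM) :
    ∃ C > 0, ∀ N M LQ LR : ℕ, 1 ≤ N → 1 ≤ M → 1 ≤ LQ → 1 ≤ LR →
      ∀ τ h q r : ℝ, τ = T / N → h = ℓ / M → q = (CM - Cm) / LQ →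
        r = (kernelSup ℓ J - kernelInf ℓ J) / LR →
      ∀ (idxQ : ℝ → Fin (LQ + 1)) (idxR : ℝ → Fin (LR + 1)),
        IsNearestIndex (mesh LQ CM q) idxQ →
        IsNearestIndex (mesh LR (kernelSup ℓ J) r) idxR →
        linftyL1Norm T ℓ (fun t x => u t x -
          interpolant h τ (scheme (M := M) h τ J A f u₀ (mesh LQ CM q)
            (mesh LR (kernelSup ℓ J) r) idxQ idxR) t x)
          ≤ ENNReal.ofReal (C * (τ + h + q + r)) := by
  have hnb := restrict_cube_neBot (d := d) hℓ
  have hur := hu.ae_forall_mem_Icc hT hrange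
  have hCmM : Cm ≤ CM := by
    obtain ⟨x, hx⟩ := hur.exists
    have := hx 0 ⟨le_rfl, hT.le⟩
    exact this.1.trans this.2
  obtain ⟨V, hV0, hV⟩ := hu.exists_variation_le
  obtain ⟨K, hK⟩ := hu.lipschitz
  have hAc : Continuous A := hA.locallyLipschitz.continuous
  obtain ⟨LA, hLA⟩ := (hA.locallyLipschitz.locallyLipschitzOn
    (s := Icc (-(CM - Cm)) (CM - Cm))).exists_lipschitzOnWith_of_compact isCompact_Icc
  obtain ⟨AB, hAB⟩ := (isCompact_Icc (a := -(CM - Cm)) (b := CM - Cm)).exists_bound_of_continuousOn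
    hAc.continuousOn
  have hAB0 : 0 ≤ AB := (norm_nonneg _).trans (hAB 0 ⟨by linarith, by linarith⟩)
  have hJI := ae_kernel_mem_Icc hJb
  have hJIS := kernelInf_le_kernelSup hℓ hJb
  set JB : ℝ := max |kernelInf ℓ J| |kernelSup ℓ J| with hJBdef
  have hJB0 : 0 ≤ JB := (abs_nonneg _).trans (le_max_left _ _)
  obtain ⟨Cf, hCf, hgrow⟩ := hf.growth
  -- The stability bound is fixed before the mesh parameters, hence so is the Lipschitz constant
  -- `Kf` of `f` on `[-R, R]`.
  set R : ℝ := (max |Cm| |CM| + T * (JB * AB * ℓ ^ d + Cf)) * Real.exp (Cf * T) with hRdef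
  obtain ⟨Kf, hKf⟩ := hf.lipschitz R
  have hIR : Icc Cm CM ⊆ Icc (-R) R := by
    intro s hs
    refine abs_le.1 ((abs_le_max_abs_abs hs.1 hs.2).trans ?_)
    have h1 : 0 ≤ T * (JB * AB * ℓ ^ d + Cf) := by positivity
    have h2 : (0 : ℝ) ≤ max |Cm| |CM| := (abs_nonneg _).trans (le_max_left _ _)
    calc max |Cm| |CM| ≤ max |Cm| |CM| + T * (JB * AB * ℓ ^ d + Cf) := le_add_of_nonneg_right h1
      _ ≤ R := le_mul_of_one_le_right (by positivity) (Real.one_le_exp (by positivity))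
  have hum : ∀ t ∈ Icc 0 T, AEStronglyMeasurable (u t) (volume.restrict (cube d ℓ)) :=
    fun t ht => (hu.memLinfty t ht).1
  have hui : ∀ t ∈ Icc 0 T, IntegrableOn (u t) (cube d ℓ) := fun t ht =>
    integrableOn_of_ae_mem_Icc (hum t ht) (hur.mono fun x hx => hx t ht)
  have hu₀r : ∀ᵐ x ∂(volume.restrict (cube d ℓ)), u₀ x ∈ Icc Cm CM := by
    filter_upwards [hur, hu.initial] with x h1 h2
    exact h2 ▸ h1 0 ⟨le_rfl, hT.le⟩
  have hfi : ∀ s, IntegrableOn (fun p : ℝ × (Fin d → ℝ) => f p.1 p.2 s) (timeSpace d T ℓ) :=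
    fun s => memLp_one_iff_integrable.1 (hf.memBV s).1
  set P : ℝ := 2 ^ d * d * V with hP
  have hP0 : 0 ≤ P := by positivity
  set c : ℝ := 4 * JB * LA * ℓ ^ d + Kf with hc
  have hc0 : 0 ≤ c := by positivity
  set c₁ : ℝ := 4 * JB * LA * K * (ℓ ^ d) ^ 2 + Kf * K * ℓ ^ d with hc₁
  have hc₁0 : 0 ≤ c₁ := by positivity
  set c₂ : ℝ := 2 * JB * LA * (ℓ ^ d) ^ 2 with hc₂
  have hc₂0 : 0 ≤ c₂ := by positivity
  set c₃ : ℝ := AB * (ℓ ^ d) ^ 2 with hc₃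
  have hc₃0 : 0 ≤ c₃ := by positivity
  set c₄ : ℝ := c * P + c₁ + c₂ + c₃ with hc₄
  have hc₄0 : 0 ≤ c₄ := by positivity
  -- In order: the lag between `t` and `t_n`, the Poincaré error, the discrete error from Grönwall,
  -- and 1 for positivity.
  refine ⟨K * ℓ ^ d + P + T * c₄ * Real.exp (c * T) + 1, by positivity, ?_⟩
  intro N M LQ LR hN hM hLQ hLR τ h q r hτ hh hq hr idxQ idxR hidxQ hidxR
  have hN0 : (0 : ℝ) < N := by exact_mod_cast hN
  have hM0 : (0 : ℝ) < M := by exact_mod_cast hM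
  have hτ0 : 0 < τ := hτ ▸ div_pos hT hN0
  have hh0 : 0 < h := hh ▸ div_pos hℓ hM0
  have hq0 : 0 ≤ q := hq ▸ div_nonneg (sub_nonneg.2 hCmM) (Nat.cast_nonneg _)
  have hr0 : 0 ≤ r := hr ▸ div_nonneg (sub_nonneg.2 hJIS) (Nat.cast_nonneg _)
  have hNτ : N * τ = T := by rw [hτ]; field_simp
  have hMh : M * h = ℓ := by rw [hh]; field_simp
  have hqm : ∀ i, mesh LQ CM q i ∈ Icc Cm CM := mesh_mem_Icc hLQ hCmM hq
  have hrm : ∀ m, |mesh LR (kernelSup ℓ J) r m| ≤ JB := fun m =>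
    have := mesh_mem_Icc hLR hJIS hr m
    abs_le_max_abs_abs this.1 this.2
  set w := scheme (M := M) h τ J A f u₀ (mesh LQ CM q) (mesh LR (kernelSup ℓ J) r) idxQ idxR
    with hw
  have hwR : ∀ n ≤ N, ∀ j, |w n j| ≤ R := fun n hn j =>
    abs_scheme_le hℓ hh0 hMh hτ0 hNτ hJb.1 hAB hAB0 hJB0 hidxQ.1 hidxR.1 hqm hrm hCf hgrow
      (memLp_one_iff_integrable.1 hu₀.memBV.1) hu₀r hn j
  have htime : ∀ n ≤ N, (n : ℝ) * τ ∈ Icc 0 T := fun n hn =>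
    ⟨by positivity, hNτ ▸ mul_le_mul_of_nonneg_right (by exact_mod_cast hn) hτ0.le⟩
  set e : ℕ → ℝ := fun n => ∑ j : Fin d → Fin M, h ^ d * |cellMean h (u (n * τ)) j - w n j|
    with he
  have hm : ∀ n ≤ N, ∫ x in cube d ℓ, |u (n * τ) x - stepFun h (w n) x| ≤ P * h + e n :=
    fun n hn => integral_abs_sub_stepFun_le hh0 hMh (hu.memBV _ (htime n hn))
      (hV _ (htime n hn)) (w n)
  -- The scheme starts from the exact cell means of `u₀`.
  have he0 : e 0 ≤ 0 := by
    refine le_of_eq (Finset.sum_eq_zero fun j _ => ?_)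
    have : cellMean h (u ((0 : ℕ) * τ)) j = w 0 j := by
      show _ = cellMean h u₀ j
      rw [cellMean, cellMean, Nat.cast_zero, zero_mul]
      congr 1
      exact integral_congr_ae (ae_restrict_cell_of_cube hh0 hMh j hu.initial)
    rw [this, sub_self, abs_zero, mul_zero]
  set σ := τ + h + q + r with hσ
  have hrec : ∀ n < N, e (n + 1) ≤ e n + τ * (c * e n + c₄ * σ) := by
    intro n hn
    have hn1 : ((n : ℝ) + 1) * τ ≤ T := by
      have := (htime (n + 1) hn).2
      push_cast at this
      exact this
    have h1 := sum_abs_error_step_le (r := mesh LR (kernelSup ℓ J) r) hℓ hh0 hMh hτ0 hn1 hAc hLA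
      hAB hJB0 hidxQ.1 hidxR.1 hqm
      (fun w hw ρ => hidxQ.abs_sub_mesh_le hLQ hq hw ρ) hum hur hK hu.equation hJb.1
      (hJI.mono fun z hz => abs_le_max_abs_abs hz.1 hz.2)
      -- Here a value of `J` is compared with its own quantization, so the term with factor 2
      -- vanishes.
      (δr := r) (hJI.mono fun z hz => by
        simpa using hidxR.abs_sub_mesh_le hLR hr hz (J z.1 z.2))
      hfi hKf hIR (w n) (hwR n hn.le)
    have h2 : e (n + 1) = ∑ j : Fin d → Fin M, h ^ d * |cellMean h (u (((n : ℝ) + 1) * τ)) j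
        - (w n j + τ * (discreteOp h J A (mesh LQ CM q) (mesh LR (kernelSup ℓ J) r) idxQ idxR
          (w n) j + reactionMean h τ f n j (w n j)))| := by
      simp only [he, Nat.cast_add, Nat.cast_one]
      rfl
    rw [h2]
    refine h1.trans (add_le_add le_rfl (mul_le_mul_of_nonneg_left ?_ hτ0.le))
    have h3 := mul_le_mul_of_nonneg_left (hm n hn.le) hc0
    -- The four error terms are each enlarged to a multiple of the full sum `σ`; the remainder is
    -- nonnegative.
    have h4 : c₄ * σ = c * P * h + c₁ * τ + c₂ * q + c₃ * r
        + (c * P * (τ + q + r) + c₁ * (h + q + r) + c₂ * (τ + h + r) + c₃ * (τ + h + q)) := by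
      rw [hc₄, hσ]; ring
    have h5 : 0 ≤ c * P * (τ + q + r) + c₁ * (h + q + r) + c₂ * (τ + h + r)
      + c₃ * (τ + h + q) := by positivity
    linarith
  have hσ0 : 0 ≤ σ := by positivity
  have hebound : ∀ n ≤ N, e n ≤ T * c₄ * Real.exp (c * T) * σ := by
    intro n hn
    have h1 := discrete_gronwall_le hτ0.le (by positivity : 0 ≤ c₄ * σ) hc0 le_rfl he0 hrec hn
    have h2 := (htime n hn).2
    calc e n ≤ (0 + n * τ * (c₄ * σ)) * Real.exp (c * (n * τ)) := h1
      _ ≤ (0 + T * (c₄ * σ)) * Real.exp (c * T) := by gcongr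
      _ = _ := by ring
  refine essSup_le_of_ae_le _ ?_
  filter_upwards [ae_restrict_mem measurableSet_Ioo] with t ht
  set n := ⌊t / τ⌋₊ with hn
  have ht0 : 0 ≤ t / τ := div_nonneg ht.1.le hτ0.le
  have hn1 : (n : ℝ) * τ ≤ t := (le_div_iff₀ hτ0).1 (Nat.floor_le ht0)
  have hn2 : t < ((n : ℝ) + 1) * τ := (div_lt_iff₀ hτ0).1 (Nat.lt_floor_add_one _)
  have hnN : n ≤ N := by
    have h1 : (n : ℝ) * τ < N * τ := hNτ ▸ hn1.trans_lt ht.2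
    exact_mod_cast (lt_of_mul_lt_mul_right h1 hτ0.le).le
  have htI : t ∈ Icc 0 T := ⟨ht.1.le, ht.2.le⟩
  refine (eLpNorm_sub_stepFun_le_of_lipschitz hℓ hui hK htI (htime n hnN) (w n)).trans
    (ENNReal.ofReal_le_ofReal ?_)
  have h1 := hm n hnN
  have h2 := hebound n hnN
  have h3 : K * |t - n * τ| * ℓ ^ d ≤ K * σ * ℓ ^ d := by
    rw [abs_of_nonneg (sub_nonneg.2 hn1)]
    gcongr
    linarith
  have h4 : P * h ≤ P * σ := mul_le_mul_of_nonneg_left (by linarith) hP0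
  linarith
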